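/- Let $\mathbb{E}$ be a complete local principal ideal domain (that is, a field or a complete discrete valuation ring), and let $\varpi$ be a generator of its maximal ideal. Let $\mathcal{T}$ be an $\mathbb{E}$-linear triangulated category equipped with a Tate twist, i.e. an autoequivalence of triangulated categories $\langle 1\rangle:\mathcal{T}\to\mathcal{T}$, with powers $\langle k\rangle$, $k\in\mathbb{Z}$. Assume that $\mathcal{T}$ is graded $\mathrm{Hom}$-finite: for all $X,Y\in\mathcal{T}$ the $\mathbb{E}$-module $\bigoplus_{k\in\mathbb{Z}}\mathrm{Hom}(X,Y\langle k\rangle)$ is finitely generated. Let $(I,\le)$ be an ordered set isomorphic to a subset of $(\mathbb{Z}_{\ge 0},\le)$, and let $\{\nabla_i\}_{i\in I}$ be a graded exceptional sequence in $\mathcal{T}$, i.e. a family of objects such that (1) if $i<j$, then $\mathrm{Hom}(\nabla_i,\nabla_j[n]\langle k\rangle)=0$ for all $n,k\in\mathbb{Z}$; (2) $\mathrm{Hom}(\nabla_i,\nabla_i[n]\langle k\rangle)=0$ unless $n=k=0$, and $\mathrm{End}(\nabla_i)\cong\mathbb{E}$; (3) the objects $\nabla_i\langle k\rangle$ ($i\in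 I$, $k\in\mathbb{Z}$) generate $\mathcal{T}$ as a triangulated category. For $i\in I$ let $\mathcal{T}_{\le i}$ (resp. $\mathcal{T}_{<i}$) be the full triangulated subcategory generated by the $\nabla_j\langle k\rangle$ with $k\in\mathbb{Z}$ and $j\le i$ (resp. $j<i$), and let $\Pi_i:\mathcal{T}_{\le i}\to\mathcal{T}_{\le i}/\mathcal{T}_{<i}$ be the Verdier quotient functor. Assume that the sequence is dualizable, with dual sequence $\{\Delta_i\}_{i\in I}$, i.e. the $\Delta_i$ are objects such that (a) if $i<j$, then $\mathrm{Hom}(\Delta_j,\nabla_i[n]\langle k\rangle)=0$ for all $n,k\in\mathbb{Z}$; (b) for each $i\in I$, $\Delta_i\in\mathcal{T}_{\le i}$ and $\Pi_i(\Delta_i)\cong\Pi_i(\nabla_i)$. Put $\bar\nabla_i=\mathrm{cone}(\nabla_i\xrightarrow{\varpi\cdot\mathrm{id}}\nabla_i)$ if $\mathbb{E}$ is not a field, and $\bar\nabla_i=0$ if $\mathbb{E}$ is a field. Let $\mathcal{T}^{\le 0}$ be the full subcategory of $\mathcal{T}$ generated under extensions by the zero object and the objects $\Delta_j[n]\langle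 k\rangle$ with $j\in I$, $n\ge 0$, $k\in\mathbb{Z}$, and let $\mathcal{T}^{\ge 0}$ be the full subcategory generated under extensions by the zero object and the objects $\nabla_j[n]\langle k\rangle$ and $\bar\nabla_j[n]\langle k\rangle$ with $j\in I$, $n\le 0$, $k\in\mathbb{Z}$. Then $(\mathcal{T}^{\le 0},\mathcal{T}^{\ge 0})$ is a t-structure on $\mathcal{T}$. Its heart $\mathscr{A}=\mathcal{T}^{\le 0}\cap\mathcal{T}^{\ge 0}$ is a noetherian abelian category (every object satisfies the ascending chain condition on subobjects). If $\mathbb{E}$ is a field, then $\mathscr{A}$ is also artinian (every object satisfies the descending chain condition on subobjects). -/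

import Mathlib

open CategoryTheory CategoryTheory.Limits CategoryTheory.Pretriangulated

open scoped ZeroObject

universe v u w w'

namespace ExcSeq

section Generation

variable {C : Type u} [Category.{v} C] [Preadditive C] [HasZeroObject C] [HasShift C ℤ]
  [∀ n : ℤ, (shiftFunctor C n).Additive] [Pretriangulated C]

/-- The (strictly full) subcategory generated under extensions by the objects satisfying `P`:
the smallest class of objects that contains `P` and the zero objects and is closed under
extensions. Closure under isomorphisms follows, see `extClosure_of_iso`. -/
inductive extClosure (P : ObjectProperty C) : ObjectProperty C
  | of (X : C) (hX : P X) : extClosure P X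
  | zero (X : C) (hX : IsZero X) : extClosure P X
  | ext (T : Triangle C) (hT : T ∈ distTriang C) (h₁ : extClosure P T.obj₁)
      (h₃ : extClosure P T.obj₃) : extClosure P T.obj₂

/-- The (strictly full) triangulated subcategory generated by the objects satisfying `P`:
the smallest class of objects that contains `P` and the zero objects and is closed under
shifts and extensions. -/
inductive triClosure (P : ObjectProperty C) : ObjectProperty C
  | of (X : C) (hX : P X) : triClosure P X
  | zero (X : C) (hX : IsZero X) : triClosure P X
  | shift (X : C) (n : ℤ) (hX : triClosure P X) : triClosure P (X⟦n⟧)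
  | ext (T : Triangle C) (hT : T ∈ distTriang C) (h₁ : triClosure P T.obj₁)
      (h₃ : triClosure P T.obj₃) : triClosure P T.obj₂

theorem distinguished_of_iso {X Y : C} (e : X ≅ Y) :
    Triangle.mk e.hom (0 : Y ⟶ 0) 0 ∈ distTriang C :=
  isomorphic_distinguished _ (contractible_distinguished X) _
    (Triangle.isoMk _ _ (Iso.refl _) e.symm (Iso.refl _)
      (by change e.hom ≫ e.inv = 𝟙 X ≫ 𝟙 X; simp)
      (by change (0 : Y ⟶ 0) ≫ 𝟙 _ = e.inv ≫ 0; simp)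
      (by change (0 : (0 : C) ⟶ X⟦(1 : ℤ)⟧) ≫ (shiftFunctor C 1).map (𝟙 X) = 𝟙 _ ≫ 0; simp))

theorem extClosure_of_iso (P : ObjectProperty C) {X Y : C} (e : X ≅ Y)
    (hX : extClosure P X) : extClosure P Y :=
  extClosure.ext _ (distinguished_of_iso e) hX (extClosure.zero _ (isZero_zero C))

theorem triClosure_of_iso (P : ObjectProperty C) {X Y : C} (e : X ≅ Y)
    (hX : triClosure P X) : triClosure P Y :=
  triClosure.ext _ (distinguished_of_iso e) hX (triClosure.zero _ (isZero_zero C))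

instance triClosure_isClosedUnderIsomorphisms (P : ObjectProperty C) :
    (triClosure P).IsClosedUnderIsomorphisms where
  of_iso e hX := triClosure_of_iso P e hX

instance triClosure_isTriangulated (P : ObjectProperty C) : (triClosure P).IsTriangulated where
  exists_zero := ⟨0, isZero_zero C, triClosure.zero _ (isZero_zero C)⟩
  isStableUnderShiftBy n := { le_shift := fun X hX => triClosure.shift X n hX }
  ext₂' T hT h₁ h₃ := ObjectProperty.le_isoClosure _ _ (triClosure.ext T hT h₁ h₃)

end Generation

section Twist

variable {C : Type u} [Category.{v} C]

/-- The twisted object `X⟨k⟩`, for the autoequivalence `F = ⟨1⟩`. -/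
abbrev twist (F : C ≌ C) (k : ℤ) (X : C) : C := (F ^ k).functor.obj X

/-- `C` is graded Hom-finite: each `⨁_k Hom(X, Y⟨k⟩)` is a finitely generated `E`-module. -/
def GradedHomFinite (E : Type w) [CommRing E] [Preadditive C] [Linear E C] (F : C ≌ C) : Prop :=
  ∀ X Y : C, Module.Finite E (DirectSum ℤ fun k => (X ⟶ twist F k Y))

end Twist

section Sequences

variable {C : Type u} [Category.{v} C] [Preadditive C] [HasZeroObject C] [HasShift C ℤ]
  [∀ n : ℤ, (shiftFunctor C n).Additive] [Pretriangulated C]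
  {I : Type w'}

/-- The triangulated subcategory generated by the `∇_j⟨k⟩` with `j` in `S`. -/
def generated (F : C ≌ C) (nabla : I → C) (S : Set I) : ObjectProperty C :=
  triClosure fun X => ∃ j ∈ S, ∃ k : ℤ, X = twist F k (nabla j)

instance generated_isClosedUnderIsomorphisms (F : C ≌ C) (nabla : I → C) (S : Set I) :
    (generated F nabla S).IsClosedUnderIsomorphisms :=
  triClosure_isClosedUnderIsomorphisms _

instance generated_isTriangulated (F : C ≌ C) (nabla : I → C) (S : Set I) :
    (generated F nabla S).IsTriangulated :=
  triClosure_isTriangulated _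

theorem generated_twist_zero (F : C ≌ C) (nabla : I → C) (S : Set I) {j : I} (hj : j ∈ S) :
    generated F nabla S (nabla j) :=
  triClosure.of _ ⟨j, hj, 0, rfl⟩

section Order

variable [LinearOrder I]

/-- A graded exceptional sequence (the index set is moreover required to embed into `ℕ`). -/
structure IsExceptional (E : Type w) [CommRing E] [Linear E C] (F : C ≌ C) (nabla : I → C) :
    Prop where
  index : Nonempty (I ↪o ℕ)
  hom_eq_zero : ∀ i j : I, i < j → ∀ (n k : ℤ) (f : nabla i ⟶ twist F k ((nabla j)⟦n⟧)), f = 0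
  self_hom_eq_zero : ∀ (i : I) (n k : ℤ), ¬(n = 0 ∧ k = 0) →
    ∀ f : nabla i ⟶ twist F k ((nabla i)⟦n⟧), f = 0
  end_equiv : ∀ i : I, Nonempty (End (nabla i) ≃ₐ[E] E)
  generates : ∀ X : C, generated F nabla Set.univ X

/-- The triangulated subcategory `T_{≤ i}`, as a category. -/
abbrev TLE (F : C ≌ C) (nabla : I → C) (i : I) : Type u :=
  (generated F nabla (Set.Iic i)).FullSubcategory

/-- `T_{< i}`, as a triangulated subcategory of `T_{≤ i}`. -/
abbrev TLT (F : C ≌ C) (nabla : I → C) (i : I) : ObjectProperty (TLE F nabla i) :=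
  (generated F nabla (Set.Iio i)).inverseImage (generated F nabla (Set.Iic i)).ι

/-- The Verdier quotient functor `Π_i : T_{≤ i} ⥤ T_{≤ i} / T_{< i}`. -/
abbrev quotientFunctor (F : C ≌ C) (nabla : I → C) (i : I) :
    TLE F nabla i ⥤ (TLT F nabla i).trW.Localization :=
  (TLT F nabla i).trW.Q

/-- `∇_i` as an object of `T_{≤ i}`. -/
abbrev nablaLE (F : C ≌ C) (nabla : I → C) (i : I) : TLE F nabla i :=
  ⟨nabla i, generated_twist_zero F nabla (Set.Iic i) (Set.mem_Iic.mpr le_rfl)⟩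

/-- The family `delta` is a dual sequence to `nabla`. -/
structure IsDual (F : C ≌ C) (nabla delta : I → C) : Prop where
  hom_eq_zero : ∀ i j : I, i < j → ∀ (n k : ℤ) (f : delta j ⟶ twist F k ((nabla i)⟦n⟧)), f = 0
  quotient_iso : ∀ i : I, ∃ h : generated F nabla (Set.Iic i) (delta i),
    Nonempty ((quotientFunctor F nabla i).obj ⟨delta i, h⟩ ≅
      (quotientFunctor F nabla i).obj (nablaLE F nabla i))

end Order

/-- `B` is a model of the object attached to `N`: a cone of `ϖ · id : N ⟶ N` if `E` is not a
field, a zero object if `E` is a field. -/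
def IsReduction {E : Type w} [CommRing E] [Linear E C] (ϖ : E) (N B : C) : Prop :=
  (IsField E ∧ IsZero B) ∨
    (¬ IsField E ∧ ∃ (g : N ⟶ B) (h : B ⟶ N⟦(1 : ℤ)⟧),
      Triangle.mk (ϖ • 𝟙 N) g h ∈ distTriang C)

/-- Generated under extensions by the `Δ_j[n]⟨k⟩` with `n ≥ 0`. -/
def tLE (F : C ≌ C) (delta : I → C) : ObjectProperty C :=
  extClosure fun X => ∃ (j : I) (n k : ℤ), 0 ≤ n ∧ X = twist F k ((delta j)⟦n⟧)

/-- Generated under extensions by the `∇_j[n]⟨k⟩` and the (cone of `ϖ` on `∇_j`)`[n]⟨k⟩`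
with `n ≤ 0`. -/
def tGE {E : Type w} [CommRing E] [Linear E C] (ϖ : E) (F : C ≌ C) (nabla : I → C) :
    ObjectProperty C :=
  extClosure fun X => ∃ (j : I) (n k : ℤ), n ≤ 0 ∧
    (X = twist F k ((nabla j)⟦n⟧) ∨
      ∃ B : C, IsReduction ϖ (nabla j) B ∧ X = twist F k (B⟦n⟧))

end Sequences

end ExcSeq

set_option linter.unusedSectionVars false

/-! Twists are absorbed into the index: the objects N_(i,k) = ∇_i⟨k⟩ and D_(i,k) = Δ_i⟨k⟩ carry the
position of i in ℕ as level, and `IsDualPair` records what is used of them (`isDualPair_twist`).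
Dualizability yields a map Δ_i → ∇_i with cone in T_{<i} (`exists_comparison`), so Hom(D_i, N_j[n])
= 0 unless i = j and n = 0. Injectivity of ϖ on End(∇_j) extends this to the reductions
(`hom_dual_exc'`), which makes T^{≤0} orthogonal to T^{≥1}.

For truncation triangles, let P ∗ Q be the class of middle terms of triangles from P to Q, and let
𝓓, 𝓔 be the parts of T^{≤0}, T^{≥1} generated in level m. By induction on m it suffices that
T_{<m+1} ⊆ 𝓓 ∗ T_{<m} ∗ 𝓔 (`belowLevel_succ_le`). The right side contains all shifts of the
generators, so it remains to close it under extensions, that is, to exchange factors standing in the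
wrong order. Orthogonality does this except for 𝓔 ∗ 𝓓, where a nonzero connecting map D_j → N_j, or
from D_j to a reduction, may occur. The octahedral axiom shows that its fibre still has the required
form (`fiber_mem`): a nonzero endomorphism of ∇_j is a unit times a power of ϖ, so its cone is
filtered by reductions, and a nonzero map from ∇_j to its reduction is, up to an automorphism, the
projection, whose fibre is ∇_j.

In the heart, Hom(D_j, X[n]) = 0 for n ≠ 0 when X has level at most that of j. In this range
Hom(D_j, -) is exact and detects the top level. Along a chain of quotients, graded Hom-finiteness
stabilises the kernels of these functors, and the levels are removed from the top down
(`exists_kernel_mem`); this is noetherianity. Over a field the reductions vanish and Hom(-, N_j)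
plays the same role on the opposite category, which gives artinianity. -/

namespace ExcSeq

open ObjectProperty

/-! ### Calculus of extension products of classes of objects. -/

section ExtensionProduct

variable {C : Type u} [Category.{v} C] [Preadditive C] [HasZeroObject C] [HasShift C ℤ]
  [∀ n : ℤ, (shiftFunctor C n).Additive] [Pretriangulated C]

local infixr:70 " ∗ " => ObjectProperty.extensionProduct

theorem distinguished_of_isos {X Y Z X' Y' Z' : C} {f : X ⟶ Y} {g : Y ⟶ Z} {h : Z ⟶ X⟦(1 : ℤ)⟧}
    (hT : Triangle.mk f g h ∈ distTriang C) {f' : X' ⟶ Y'} {g' : Y' ⟶ Z'}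
    {h' : Z' ⟶ X'⟦(1 : ℤ)⟧} (α : X' ≅ X) (β : Y' ≅ Y) (γ : Z' ≅ Z)
    (h₁ : f' ≫ β.hom = α.hom ≫ f) (h₂ : g' ≫ γ.hom = β.hom ≫ g)
    (h₃ : h' ≫ α.hom⟦(1 : ℤ)⟧' = γ.hom ≫ h) : Triangle.mk f' g' h' ∈ distTriang C :=
  isomorphic_distinguished _ hT _ (Triangle.isoMk _ _ α β γ h₁ h₂ h₃)

theorem extensionProduct_mono {P P' Q Q' : ObjectProperty C} (hP : P ≤ P') (hQ : Q ≤ Q') :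
    P ∗ Q ≤ P' ∗ Q' :=
  (monotone_extensionProduct_left Q hP).trans (monotone_extensionProduct_right P' hQ)

theorem extensionProduct_of_distTriang {P Q : ObjectProperty C} (T : Triangle C)
    (hT : T ∈ distTriang C) (h₁ : P T.obj₁) (h₃ : Q T.obj₃) : (P ∗ Q) T.obj₂ :=
  ⟨T.obj₁, T.obj₃, T.mor₁, T.mor₂, T.mor₃, hT, h₁, h₃⟩

/-- An extension whose connecting morphism vanishes may be read in the opposite order. -/
theorem extensionProduct_swap_of_zero {P Q : ObjectProperty C} (T : Triangle C)
    (hT : T ∈ distTriang C) (h₁ : P T.obj₁) (h₃ : Q T.obj₃) (h : T.mor₃ = 0) :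
    (Q ∗ P) T.obj₂ := by
  obtain ⟨e, -, -⟩ := exists_iso_binaryBiproduct_of_distTriang T hT h
  exact (Q ∗ P).prop_of_iso ((biprod.braiding _ _) ≪≫ e.symm)
    (extensionProduct_of_distTriang (binaryBiproductTriangle T.obj₃ T.obj₁)
      (binaryBiproductTriangle_distinguished _ _) h₃ h₁)

theorem extensionProduct_swap {P Q : ObjectProperty C}
    (h : ∀ ⦃X Y : C⦄, Q X → P Y → ∀ f : X ⟶ Y⟦(1 : ℤ)⟧, f = 0) : P ∗ Q ≤ Q ∗ P := by
  rintro X ⟨Y, Z, f, g, k, hT, hY, hZ⟩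
  exact extensionProduct_swap_of_zero (Triangle.mk f g k) hT hY hZ (h hZ hY k)

instance extClosure_isClosedUnderIsomorphisms (P : ObjectProperty C) :
    (extClosure P).IsClosedUnderIsomorphisms where
  of_iso e hX := extClosure_of_iso P e hX

instance extClosure_isTriangulatedClosed₂ (P : ObjectProperty C) :
    (extClosure P).IsTriangulatedClosed₂ :=
  .mk' fun T hT h₁ h₃ => extClosure.ext T hT h₁ h₃

instance extClosure_containsZero (P : ObjectProperty C) : (extClosure P).ContainsZero where
  exists_zero := ⟨0, isZero_zero C, extClosure.zero _ (isZero_zero C)⟩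

theorem le_extClosure (P : ObjectProperty C) : P ≤ extClosure P :=
  fun X hX => extClosure.of X hX

theorem prop_of_isZero (Q : ObjectProperty C) [Q.ContainsZero] [Q.IsClosedUnderIsomorphisms]
    {X : C} (hX : IsZero X) : Q X := by
  obtain ⟨Z, hZ, hQ⟩ := Q.exists_prop_of_containsZero
  exact Q.prop_of_iso (hZ.iso hX) hQ

theorem extClosure_le {P Q : ObjectProperty C} [Q.ContainsZero] [Q.IsClosedUnderIsomorphisms]
    [Q.IsTriangulatedClosed₂] (h : P ≤ Q) : extClosure P ≤ Q := by
  intro X hX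
  induction hX with
  | of X hX => exact h X hX
  | zero X hX => exact prop_of_isZero Q hX
  | ext T hT _ _ ih₁ ih₃ => exact Q.ext_of_isTriangulatedClosed₂ T hT ih₁ ih₃

theorem triClosure_le {P Q : ObjectProperty C} [Q.IsTriangulated] [Q.IsClosedUnderIsomorphisms]
    (h : P ≤ Q) : triClosure P ≤ Q := by
  intro X hX
  induction hX with
  | of X hX => exact h X hX
  | zero X hX => exact prop_of_isZero Q hX
  | shift X n _ ih => exact Q.le_shift n X ih
  | ext T hT _ _ ih₁ ih₃ => exact Q.ext_of_isTriangulatedClosed₂ T hT ih₁ ih₃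

theorem le_triClosure (P : ObjectProperty C) : P ≤ triClosure P :=
  fun X hX => triClosure.of X hX

theorem triClosure_mono {P Q : ObjectProperty C} (h : P ≤ Q) : triClosure P ≤ triClosure Q :=
  triClosure_le (h.trans (le_triClosure Q))

theorem extClosure_mono {P Q : ObjectProperty C} (h : P ≤ Q) : extClosure P ≤ extClosure Q :=
  extClosure_le (h.trans (le_extClosure Q))

theorem extensionProduct_self_le {P : ObjectProperty C} [P.IsTriangulatedClosed₂]
    [P.IsClosedUnderIsomorphisms] : P ∗ P ≤ P :=
  extensionProduct_le_of_isTriangulatedClosed₂ le_rfl le_rfl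

instance extensionProduct_containsZero (P Q : ObjectProperty C) [P.ContainsZero]
    [Q.ContainsZero] : (P ∗ Q).ContainsZero where
  exists_zero := by
    obtain ⟨Z, hZ, hP⟩ := P.exists_prop_of_containsZero
    exact ⟨Z, hZ, le_extensionProduct_left Q Z hP⟩

theorem isTriangulatedClosed₂_of_extensionProduct_le {P : ObjectProperty C}
    [P.IsClosedUnderIsomorphisms] (h : P ∗ P ≤ P) : P.IsTriangulatedClosed₂ :=
  .mk' fun T hT h₁ h₃ => h _ (extensionProduct_of_distTriang T hT h₁ h₃)

/-- A class closed under extensions that contains all shifts of the objects of `P` contains the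
triangulated subcategory generated by `P`. -/
theorem triClosure_le_of_shift {P Q : ObjectProperty C} [Q.ContainsZero]
    [Q.IsClosedUnderIsomorphisms] [Q.IsTriangulatedClosed₂]
    (h : ∀ X, P X → ∀ n : ℤ, Q (X⟦n⟧)) : triClosure P ≤ Q := by
  suffices ∀ X, triClosure P X → ∀ n : ℤ, Q (X⟦n⟧) from fun X hX =>
    Q.prop_of_iso ((shiftFunctorZero C ℤ).app X) (this X hX 0)
  intro X hX
  induction hX with
  | of X hX => exact h X hX
  | zero X hX => exact fun n => prop_of_isZero Q ((shiftFunctor C n).map_isZero hX)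
  | shift X m _ ih =>
    exact fun n => Q.prop_of_iso ((shiftFunctorAdd' C m n (m + n) rfl).app X) (ih (m + n))
  | ext T hT _ _ ih₁ ih₃ =>
    exact fun n => Q.ext_of_isTriangulatedClosed₂ _ (Triangle.shift_distinguished T hT n)
      (ih₁ n) (ih₃ n)

theorem extClosure_shift {P Q : ObjectProperty C} (n : ℤ)
    (h : ∀ X, P X → extClosure Q (X⟦n⟧)) {X : C} (hX : extClosure P X) :
    extClosure Q (X⟦n⟧) := by
  induction hX with
  | of X hX => exact h X hX
  | zero X hX => exact extClosure.zero _ ((shiftFunctor C n).map_isZero hX)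
  | ext T hT _ _ ih₁ ih₃ =>
    exact extClosure.ext _ (Triangle.shift_distinguished T hT n) ih₁ ih₃

section

variable [IsTriangulated C]

/-- Induction on the word of generators on the left: by associativity, (V ∗ V') ∗ Q = V ∗ (V' ∗ Q) ⊆
V ∗ R, and `hR` absorbs this into R. -/
theorem extClosure_extensionProduct_le {G Q R : ObjectProperty C} [R.IsClosedUnderIsomorphisms]
    (hG : G ∗ Q ≤ R) (h₀ : Q ≤ R) (hR : ∀ V : ObjectProperty C, V ∗ Q ≤ R → V ∗ R ≤ R) :
    extClosure G ∗ Q ≤ R := by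
  suffices ∀ X, extClosure G X → (fun Y => Y = X) ∗ Q ≤ R by
    rintro X ⟨Y, Z, f, g, k, hT, hY, hZ⟩
    exact this Y hY X ⟨Y, Z, f, g, k, hT, rfl, hZ⟩
  intro X hX
  induction hX with
  | of X hX =>
    refine (extensionProduct_mono ?_ le_rfl).trans hG
    rintro _ rfl
    exact hX
  | zero X hX =>
    rintro Z ⟨_, Y, f, g, k, hT, rfl, hY⟩
    have : IsIso g := (Triangle.isZero₁_iff_isIso₂ _ hT).1 hX
    exact R.prop_of_iso (asIso g).symm (h₀ Y hY)
  | ext T hT _ _ ih₁ ih₃ =>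
    refine le_trans (extensionProduct_mono (P' := (fun Y => Y = T.obj₁) ∗ (fun Y => Y = T.obj₃))
      ?_ le_rfl) ?_
    · rintro _ rfl
      exact extensionProduct_of_distTriang T hT rfl rfl
    · rw [extensionProduct_assoc]
      exact (extensionProduct_mono le_rfl ih₃).trans (hR _ ih₁)

theorem extensionProduct_extClosure_le {G Q R : ObjectProperty C} [R.IsClosedUnderIsomorphisms]
    (hG : Q ∗ G ≤ R) (h₀ : Q ≤ R) (hR : ∀ V : ObjectProperty C, Q ∗ V ≤ R → R ∗ V ≤ R) :
    Q ∗ extClosure G ≤ R := by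
  suffices ∀ X, extClosure G X → Q ∗ (fun Y => Y = X) ≤ R by
    rintro X ⟨Y, Z, f, g, k, hT, hY, hZ⟩
    exact this Z hZ X ⟨Y, Z, f, g, k, hT, hY, rfl⟩
  intro X hX
  induction hX with
  | of X hX =>
    refine (extensionProduct_mono le_rfl ?_).trans hG
    rintro _ rfl
    exact hX
  | zero X hX =>
    rintro Z ⟨Y, _, f, g, k, hT, hY, rfl⟩
    have : IsIso f := (Triangle.isZero₃_iff_isIso₁ _ hT).1 hX
    exact R.prop_of_iso (asIso f) (h₀ Y hY)
  | ext T hT _ _ ih₁ ih₃ =>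
    refine le_trans (extensionProduct_mono (Q' := (fun Y => Y = T.obj₁) ∗ (fun Y => Y = T.obj₃))
      le_rfl ?_) ?_
    · rintro _ rfl
      exact extensionProduct_of_distTriang T hT rfl rfl
    · rw [← extensionProduct_assoc]
      exact (extensionProduct_mono ih₁ le_rfl).trans (hR _ ih₃)

theorem extensionProduct_absorb_left {P P' Q R : ObjectProperty C} (h : P ∗ P' ≤ Q) :
    P ∗ (P' ∗ R) ≤ Q ∗ R := by
  rw [← extensionProduct_assoc]
  exact extensionProduct_mono h le_rfl

/-- Two classes closed under extensions, one orthogonal to the other, have an extension product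
closed under extensions. -/
theorem extensionProduct_isTriangulatedClosed₂ {P Q : ObjectProperty C}
    [P.IsTriangulatedClosed₂] [P.IsClosedUnderIsomorphisms]
    [Q.IsTriangulatedClosed₂] [Q.IsClosedUnderIsomorphisms] (h : Q ∗ P ≤ P ∗ Q) :
    (P ∗ Q).IsTriangulatedClosed₂ := by
  refine isTriangulatedClosed₂_of_extensionProduct_le ?_
  rw [extensionProduct_assoc]
  refine (extensionProduct_mono le_rfl (extensionProduct_absorb_left h)).trans ?_
  rw [extensionProduct_assoc]
  exact (extensionProduct_absorb_left extensionProduct_self_le).trans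
    (extensionProduct_mono le_rfl extensionProduct_self_le)

theorem extensionProduct_self_left_le {P Q : ObjectProperty C} [P.IsTriangulatedClosed₂]
    [P.IsClosedUnderIsomorphisms] : P ∗ (P ∗ Q) ≤ P ∗ Q :=
  extensionProduct_absorb_left extensionProduct_self_le

theorem middle_extensionProduct_triple_le {P Q R : ObjectProperty C}
    [Q.IsTriangulatedClosed₂] [Q.IsClosedUnderIsomorphisms] (hQP : Q ∗ P ≤ P ∗ Q) :
    Q ∗ (P ∗ (Q ∗ R)) ≤ P ∗ (Q ∗ R) := by
  refine (extensionProduct_absorb_left hQP).trans ?_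
  rw [extensionProduct_assoc]
  exact extensionProduct_mono le_rfl (extensionProduct_absorb_left extensionProduct_self_le)

theorem extensionProduct_pair_le {P Q R : ObjectProperty C}
    [Q.IsTriangulatedClosed₂] [Q.IsClosedUnderIsomorphisms]
    [R.IsTriangulatedClosed₂] [R.IsClosedUnderIsomorphisms] (hRQ : R ∗ Q ≤ Q ∗ R) :
    (P ∗ (Q ∗ R)) ∗ (Q ∗ R) ≤ P ∗ (Q ∗ R) := by
  have := extensionProduct_isTriangulatedClosed₂ hRQ
  rw [extensionProduct_assoc]
  exact extensionProduct_mono le_rfl extensionProduct_self_le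

/-- The word P Q R P Q R is sorted from the inside: R is moved through the second P Q R, then Q, and
finally the two copies of P merge. -/
theorem extensionProduct_triple_isTriangulatedClosed₂ {P Q R : ObjectProperty C}
    [P.IsTriangulatedClosed₂] [P.IsClosedUnderIsomorphisms]
    [Q.IsTriangulatedClosed₂] [Q.IsClosedUnderIsomorphisms]
    [R.IsTriangulatedClosed₂] [R.IsClosedUnderIsomorphisms] (hQP : Q ∗ P ≤ P ∗ Q)
    (hRQ : R ∗ Q ≤ Q ∗ R) (hRP : R ∗ P ≤ P ∗ (Q ∗ R)) :
    (P ∗ (Q ∗ R)).IsTriangulatedClosed₂ := by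
  refine isTriangulatedClosed₂_of_extensionProduct_le ?_
  have hR : R ∗ (P ∗ (Q ∗ R)) ≤ P ∗ (Q ∗ R) :=
    (extensionProduct_absorb_left hRP).trans (extensionProduct_pair_le hRQ)
  rw [extensionProduct_assoc, extensionProduct_assoc]
  exact (extensionProduct_mono le_rfl ((extensionProduct_mono le_rfl hR).trans
    (middle_extensionProduct_triple_le hQP))).trans extensionProduct_self_left_le

end

end ExtensionProduct

/-! ### Exceptional families with a dual family, and their orthogonality. -/

section DualPair

variable {C : Type u} [Category.{v} C] [Preadditive C] [HasZeroObject C] [HasShift C ℤ]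
  [∀ n : ℤ, (shiftFunctor C n).Additive] [Pretriangulated C]

local infixr:70 " ∗ " => ObjectProperty.extensionProduct

theorem hom_shift_eq_zero {X Y : C} {a b c : ℤ} (hc : c + a = b)
    (h : ∀ f : X ⟶ Y⟦c⟧, f = 0) (f : X⟦a⟧ ⟶ Y⟦b⟧) : f = 0 := by
  have h' := h ((shiftFunctor C a).preimage (f ≫ (shiftFunctorAdd' C c a b hc).hom.app Y))
  have h'' := congrArg (shiftFunctor C a).map h'
  rw [Functor.map_preimage, Functor.map_zero] at h''
  rw [← cancel_mono ((shiftFunctorAdd' C c a b hc).hom.app Y), zero_comp]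
  exact h''

theorem hom_eq_zero_of_isos {X Y X' Y' : C} (e : X ≅ X') (e' : Y ≅ Y')
    (h : ∀ f : X' ⟶ Y', f = 0) (f : X ⟶ Y) : f = 0 := by
  rw [← cancel_epi e.inv, ← cancel_mono e'.hom, comp_zero, zero_comp]
  exact h _

theorem hom_obj₃_eq_zero (T : Triangle C) (hT : T ∈ distTriang C) {W : C}
    (h₂ : ∀ y : W ⟶ T.obj₂, y = 0) (h₁ : ∀ y : W ⟶ T.obj₁⟦(1 : ℤ)⟧, y = 0)
    (f : W ⟶ T.obj₃) : f = 0 := by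
  obtain ⟨y, rfl⟩ := Triangle.coyoneda_exact₃ T hT f (h₁ _)
  rw [h₂ y, zero_comp]

theorem eq_zero_of_comp_mor₁_eq_zero (T : Triangle C) (hT : T ∈ distTriang C) {W : C}
    (f : W ⟶ T.obj₁) (hf : f ≫ T.mor₁ = 0) (h : ∀ y : W ⟶ T.obj₃⟦(-1 : ℤ)⟧, y = 0) :
    f = 0 := by
  obtain ⟨y, rfl⟩ := Triangle.coyoneda_exact₂ _ (inv_rot_of_distTriang T hT) f hf
  rw [show y = 0 from h y]
  exact zero_comp

variable {J : Type w'}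

/-- The triangulated subcategory generated by the objects `N j` of level less than `m`. -/
def belowLevel (lvl : J → ℕ) (N : J → C) (m : ℕ) : ObjectProperty C :=
  triClosure fun X => ∃ j, lvl j < m ∧ X = N j

instance belowLevel_isTriangulated (lvl : J → ℕ) (N : J → C) (m : ℕ) :
    (belowLevel lvl N m).IsTriangulated :=
  triClosure_isTriangulated _

instance belowLevel_isClosedUnderIsomorphisms (lvl : J → ℕ) (N : J → C) (m : ℕ) :
    (belowLevel lvl N m).IsClosedUnderIsomorphisms :=
  triClosure_isClosedUnderIsomorphisms _

theorem belowLevel_mono (lvl : J → ℕ) (N : J → C) {m m' : ℕ} (h : m ≤ m') :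
    belowLevel lvl N m ≤ belowLevel lvl N m' :=
  triClosure_mono fun _ ⟨j, hj, hX⟩ => ⟨j, hj.trans_le h, hX⟩

theorem hom_belowLevel_eq_zero {lvl : J → ℕ} {N : J → C}
    (hN : ∀ (i j : J) (n : ℤ) (f : N i ⟶ (N j)⟦n⟧), lvl i < lvl j → f = 0)
    {j : J} {m : ℕ} (hm : m ≤ lvl j) {X : C} (hX : belowLevel lvl N m X) (f : X ⟶ N j) :
    f = 0 := by
  have : belowLevel lvl N m ≤ leftOrthogonal (fun Y => Y = N j) := by
    refine triClosure_le_of_shift ?_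
    rintro _ ⟨i, hi, rfl⟩ n _ g rfl
    exact hom_eq_zero_of_isos (Iso.refl _) ((shiftFunctorZero C ℤ).symm.app (N j))
      (hom_shift_eq_zero (c := -n) (by simp) fun f => hN i j _ f (hi.trans_le hm)) g
  exact this X hX f rfl

/-- An exceptional family `N`, layered by `lvl`, with a dual family `D`; the objects of `R j`
are the reductions of `N j` modulo a uniformizer of its endomorphism ring. -/
structure IsDualPair (lvl : J → ℕ) (N D : J → C) (R : J → ObjectProperty C) : Prop where
  hom_eq_zero : ∀ (i j : J) (n : ℤ) (f : N i ⟶ (N j)⟦n⟧), lvl i ≤ lvl j →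
    ¬(i = j ∧ n = 0) → f = 0
  dual_hom_eq_zero : ∀ (i j : J) (n : ℤ) (f : D j ⟶ (N i)⟦n⟧), lvl i < lvl j → f = 0
  generates : ∀ X : C, ∃ m : ℕ, belowLevel lvl N m X
  exists_comparison : ∀ j, ∃ c : D j ⟶ N j, (belowLevel lvl N (lvl j)).trW c
  cone_mem : ∀ (j : J) (X : C) (q : N j ⟶ N j) (g : N j ⟶ X) (h : X ⟶ (N j)⟦(1 : ℤ)⟧),
    Triangle.mk q g h ∈ distTriang C → q ≠ 0 → extClosure (R j) X
  reduction : ∀ (j : J) (B : C), R j B → IsZero B ∨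
    ∃ (p : N j ⟶ N j) (g : N j ⟶ B) (h : B ⟶ (N j)⟦(1 : ℤ)⟧),
      Triangle.mk p g h ∈ distTriang C ∧ (∀ q : N j ⟶ N j, q ≫ p = 0 → q = 0) ∧
      ∀ g' : N j ⟶ B, g' = 0 ∨ ∃ u : N j ≅ N j, g' = u.hom ≫ g

/-- The objects `D j[n]` with `j ∈ s` and `n ≥ -a`. -/
def dualGen (D : J → C) (s : Set J) (a : ℤ) : ObjectProperty C :=
  fun X => ∃ j ∈ s, ∃ n : ℤ, -a ≤ n ∧ Nonempty (X ≅ (D j)⟦n⟧)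

/-- The objects `N j[n]` and `B[n]`, `B` in `R j`, with `j ∈ s` and `n ≤ -a`. -/
def excGen (N : J → C) (R : J → ObjectProperty C) (s : Set J) (a : ℤ) : ObjectProperty C :=
  fun X => ∃ j ∈ s, ∃ n : ℤ, n ≤ -a ∧ ∃ B : C, (B = N j ∨ R j B) ∧ Nonempty (X ≅ B⟦n⟧)

/-- The extension closure of the objects `D j[n]` with `j ∈ s` and `n ≥ -a`. -/
def dualLE (D : J → C) (s : Set J) (a : ℤ) : ObjectProperty C := extClosure (dualGen D s a)

/-- The extension closure of the objects `N j[n]` and `B[n]`, `B` in `R j`, with `j ∈ s` and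
`n ≤ -a`. -/
def excGE (N : J → C) (R : J → ObjectProperty C) (s : Set J) (a : ℤ) : ObjectProperty C :=
  extClosure (excGen N R s a)

theorem dualLE_mono (D : J → C) {s s' : Set J} (hs : s ⊆ s') {a a' : ℤ} (h : a ≤ a') :
    dualLE D s a ≤ dualLE D s' a' :=
  extClosure_mono fun _ ⟨j, hj, n, hn, e⟩ => ⟨j, hs hj, n, by lia, e⟩

theorem excGE_mono (N : J → C) (R : J → ObjectProperty C) {s s' : Set J} (hs : s ⊆ s') {a a' : ℤ}
    (h : a' ≤ a) : excGE N R s a ≤ excGE N R s' a' :=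
  extClosure_mono fun _ ⟨j, hj, n, hn, e⟩ => ⟨j, hs hj, n, by lia, e⟩

theorem dualLE_shift (D : J → C) (s : Set J) (n a n' : ℤ) (h : a + n' = n) (X : C)
    (hX : dualLE D s n X) : dualLE D s n' (X⟦a⟧) := by
  refine extClosure_shift a ?_ hX
  rintro X ⟨j, hj, m, hm, ⟨e⟩⟩
  exact extClosure.of _ ⟨j, hj, m + a, by lia,
    ⟨(shiftFunctor C a).mapIso e ≪≫ ((shiftFunctorAdd' C m a (m + a) rfl).app (D j)).symm⟩⟩

theorem excGE_shift (N : J → C) (R : J → ObjectProperty C) (s : Set J) (n a n' : ℤ)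
    (h : a + n' = n) (X : C) (hX : excGE N R s n X) : excGE N R s n' (X⟦a⟧) := by
  refine extClosure_shift a ?_ hX
  rintro X ⟨j, hj, m, hm, B, hB, ⟨e⟩⟩
  exact extClosure.of _ ⟨j, hj, m + a, by lia, B, hB,
    ⟨(shiftFunctor C a).mapIso e ≪≫ ((shiftFunctorAdd' C m a (m + a) rfl).app B).symm⟩⟩

namespace IsDualPair

variable {lvl : J → ℕ} {N D : J → C} {R : J → ObjectProperty C}

theorem mem_belowLevel {j : J} {m : ℕ} (h : lvl j < m) : belowLevel lvl N m (N j) :=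
  triClosure.of _ ⟨j, h, rfl⟩

variable (hp : IsDualPair lvl N D R)

include hp

theorem dual_mem_belowLevel (j : J) : belowLevel lvl N (lvl j + 1) (D j) := by
  obtain ⟨c, Z, g, h, hT, hZ⟩ := hp.exists_comparison j
  exact (belowLevel lvl N (lvl j + 1)).ext_of_isTriangulatedClosed₁ _ hT
    (mem_belowLevel (Nat.lt_succ_self _)) (belowLevel_mono _ _ (Nat.le_succ _) _ hZ)

theorem hom_dual_belowLevel {j : J} {m : ℕ} (hm : m ≤ lvl j) {X : C}
    (hX : belowLevel lvl N m X) (f : D j ⟶ X) : f = 0 := by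
  have : belowLevel lvl N m ≤ rightOrthogonal (fun Y => Y = D j) := by
    refine triClosure_le_of_shift ?_
    rintro _ ⟨i, hi, rfl⟩ n _ g rfl
    exact hp.dual_hom_eq_zero i j n g (hi.trans_le hm)
  exact this X hX f rfl

theorem hom_belowLevel_exc {j : J} {m : ℕ} (hm : m ≤ lvl j) {X : C}
    (hX : belowLevel lvl N m X) (f : X ⟶ N j) : f = 0 :=
  hom_belowLevel_eq_zero (fun i j n f hij =>
    hp.hom_eq_zero i j n f hij.le (by rintro ⟨rfl, -⟩; simp at hij)) hm hX f

theorem exc_mem_rightOrthogonal {j : J} {m : ℕ} (hm : m ≤ lvl j) {B : C} (hB : B = N j ∨ R j B) :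
    (belowLevel lvl N m).rightOrthogonal B := by
  have hN : (belowLevel lvl N m).rightOrthogonal (N j) :=
    fun X f hX => hp.hom_belowLevel_exc hm hX f
  obtain rfl | hB := hB
  · exact hN
  · obtain hB | ⟨p, g, h, hT, -⟩ := hp.reduction j B hB
    · exact prop_of_isZero _ hB
    · exact ObjectProperty.ext_of_isTriangulatedClosed₃ _ _ hT hN hN

/-- The cone of `c` has lower level, so `Y` does not see it. -/
theorem comparison_bijective {j : J} {c : D j ⟶ N j} (hc : (belowLevel lvl N (lvl j)).trW c)
    {Y : C} (hY : (belowLevel lvl N (lvl j)).rightOrthogonal Y) :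
    Function.Bijective (fun f : N j ⟶ Y => c ≫ f) := by
  rw [← isLocal_trW] at hY
  exact hY c hc

/-- If i has lower level than j, then `D i` is built from objects of level below that of j. In equal
level the comparison map replaces `D i` by `N i`. The remaining case is the definition of a dual
family. -/
theorem hom_dual_exc {i j : J} {n : ℤ} (h : ¬(i = j ∧ n = 0)) (f : D i ⟶ (N j)⟦n⟧) : f = 0 := by
  obtain hij | hij | hij := lt_trichotomy (lvl i) (lvl j)
  · exact ((belowLevel lvl N (lvl j)).rightOrthogonal.le_shift n _
      (hp.exc_mem_rightOrthogonal le_rfl (Or.inl rfl))) f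
      (belowLevel_mono _ _ hij _ (hp.dual_mem_belowLevel i))
  · obtain ⟨c, hc⟩ := hp.exists_comparison i
    obtain ⟨g, rfl⟩ := (hp.comparison_bijective hc
      ((belowLevel lvl N (lvl i)).rightOrthogonal.le_shift n _
      (hp.exc_mem_rightOrthogonal hij.le (Or.inl rfl)))).2 f
    simp [hp.hom_eq_zero i j n g hij.le h]
  · exact hp.dual_hom_eq_zero j i n f hij

theorem hom_dual_exc' {i j : J} {n : ℤ} (h : ¬(i = j ∧ n = 0)) {B : C} (hB : B = N j ∨ R j B)
    (f : D i ⟶ B⟦n⟧) : f = 0 := by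
  obtain rfl | hB := hB
  · exact hp.hom_dual_exc h f
  obtain hB | ⟨p, g, k, hT, hinj, -⟩ := hp.reduction j B hB
  · exact ((shiftFunctor C n).map_isZero hB).eq_of_tgt _ _
  -- Hom(D i, B[n]) sits between Hom(D i, N j[n]) and Hom(D i, N j[n+1]). Both vanish except when i
  -- = j and n = -1; there B[-1] is the fibre of `p`, and composition with `p` is injective on Hom(D
  -- i, N i) ≅ End(N i).
  by_cases h' : i = j ∧ n = -1
  · obtain ⟨rfl, rfl⟩ := h'
    obtain ⟨c, hc⟩ := hp.exists_comparison i
    have hbij := hp.comparison_bijective hc (hp.exc_mem_rightOrthogonal le_rfl (Or.inl rfl))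
    obtain ⟨a, b, hT'⟩ : ∃ (a : B⟦(-1 : ℤ)⟧ ⟶ N i) (b : N i ⟶ B⟦(-1 : ℤ)⟧⟦(1 : ℤ)⟧),
      Triangle.mk a p b ∈ distTriang C := ⟨_, _, inv_rot_of_distTriang _ hT⟩
    have hap : a ≫ p = 0 := comp_distTriang_mor_zero₁₂ _ hT'
    refine eq_zero_of_comp_mor₁_eq_zero (Triangle.mk a p b) hT' f ?_
      (fun y => hp.hom_dual_exc (n := -1) (by simp) y)
    obtain ⟨q, hq⟩ := hbij.2 (f ≫ a)
    have h0 : c ≫ q ≫ p = c ≫ 0 := by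
      dsimp only at hq
      rw [← Category.assoc, hq, Category.assoc, hap, comp_zero, comp_zero]
    dsimp only at hq
    rw [hinj q (hbij.1 h0), comp_zero] at hq
    exact hq.symm
  · refine hom_obj₃_eq_zero _ (Triangle.shift_distinguished _ hT n) (hp.hom_dual_exc h)
      (fun y => ?_) f
    refine hom_eq_zero_of_isos (Iso.refl _)
      ((shiftFunctorAdd' C n 1 (n + 1) rfl).symm.app (N j)) (fun f => ?_) y
    exact hp.hom_dual_exc (by lia) f

end IsDualPair

end DualPair

/-! ### Truncation triangles by induction on the level. -/

section Truncation

variable {C : Type u} [Category.{v} C] [Preadditive C] [HasZeroObject C] [HasShift C ℤ]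
  [∀ n : ℤ, (shiftFunctor C n).Additive] [Pretriangulated C]
  {J : Type w'} {lvl : J → ℕ} {N D : J → C} {R : J → ObjectProperty C}

local infixr:70 " ∗ " => ObjectProperty.extensionProduct

instance dualLE_isClosedUnderIsomorphisms (s : Set J) (a : ℤ) :
    (dualLE D s a).IsClosedUnderIsomorphisms :=
  extClosure_isClosedUnderIsomorphisms _

instance dualLE_isTriangulatedClosed₂ (s : Set J) (a : ℤ) :
    (dualLE D s a).IsTriangulatedClosed₂ :=
  extClosure_isTriangulatedClosed₂ _

instance dualLE_containsZero (s : Set J) (a : ℤ) : (dualLE D s a).ContainsZero :=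
  extClosure_containsZero _

instance excGE_isClosedUnderIsomorphisms (s : Set J) (a : ℤ) :
    (excGE N R s a).IsClosedUnderIsomorphisms :=
  extClosure_isClosedUnderIsomorphisms _

instance excGE_isTriangulatedClosed₂ (s : Set J) (a : ℤ) :
    (excGE N R s a).IsTriangulatedClosed₂ :=
  extClosure_isTriangulatedClosed₂ _

instance excGE_containsZero (s : Set J) (a : ℤ) : (excGE N R s a).ContainsZero :=
  extClosure_containsZero _

/-- The zero objects and the objects `D j[n]` with `j ∈ s` and `n ≥ 0`. -/
def dualLetter (D : J → C) (s : Set J) : ObjectProperty C :=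
  fun X => IsZero X ∨ dualGen D s 0 X

instance dualLetter_containsZero (s : Set J) : (dualLetter D s).ContainsZero where
  exists_zero := ⟨0, isZero_zero C, Or.inl (isZero_zero C)⟩

theorem dualLetter_le (s : Set J) : dualLetter D s ≤ dualLE D s 0 := by
  rintro X (h | h)
  · exact extClosure.zero X h
  · exact extClosure.of X h

namespace IsDualPair

variable (hp : IsDualPair lvl N D R)

include hp

theorem dualLE_le_leftOrthogonal {m : ℕ} {s : Set J} (hs : ∀ j ∈ s, m ≤ lvl j) (a : ℤ) :
    dualLE D s a ≤ (belowLevel lvl N m).leftOrthogonal := by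
  refine extClosure_le ?_
  rintro X ⟨j, hj, n, -, ⟨e⟩⟩
  have hD : (belowLevel lvl N m).leftOrthogonal (D j) :=
    fun Y f hY => hp.hom_dual_belowLevel (hs j hj) hY f
  exact prop_of_iso _ e.symm (le_shift _ n _ hD)

theorem excGE_le_rightOrthogonal {m : ℕ} {s : Set J} (hs : ∀ j ∈ s, m ≤ lvl j) (a : ℤ) :
    excGE N R s a ≤ (belowLevel lvl N m).rightOrthogonal := by
  refine extClosure_le ?_
  rintro X ⟨j, hj, n, -, B, hB, ⟨e⟩⟩
  exact prop_of_iso _ e.symm (le_shift _ n _ (hp.exc_mem_rightOrthogonal (hs j hj) hB))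

theorem belowLevel_dualLE_swap {m : ℕ} {s : Set J} (hs : ∀ j ∈ s, m ≤ lvl j)
    {P : ObjectProperty C} (hP : P ≤ dualLE D s 0) :
    belowLevel lvl N m ∗ P ≤ P ∗ belowLevel lvl N m :=
  extensionProduct_swap fun X _ hX hY f =>
    hp.dualLE_le_leftOrthogonal hs 0 X (hP X hX) f (le_shift _ 1 _ hY)

theorem excGE_belowLevel_swap {m : ℕ} {s : Set J} (hs : ∀ j ∈ s, m ≤ lvl j) (a : ℤ) :
    excGE N R s a ∗ belowLevel lvl N m ≤ belowLevel lvl N m ∗ excGE N R s a :=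
  extensionProduct_swap fun _ Y hX hY f =>
    (le_shift _ 1 _ (hp.excGE_le_rightOrthogonal hs a Y hY)) f hX

theorem exc_mem_dual_extensionProduct {j : J} {m : ℕ} (hj : lvl j = m) {s : Set J} (hs : j ∈ s) :
    (dualLetter D s ∗ belowLevel lvl N m) (N j) := by
  obtain ⟨c, Z, g, h, hT, hZ⟩ := hp.exists_comparison j
  exact extensionProduct_of_distTriang _ hT
    (Or.inr ⟨j, hs, 0, by simp, ⟨((shiftFunctorZero C ℤ).app (D j)).symm⟩⟩) (hj ▸ hZ)

variable [IsTriangulated C]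

/-- Since `f` is the comparison map followed by some `q : N j ⟶ X`, the octahedral axiom presents
its fibre as an extension of the fibre of `q` by an object of lower level. -/
theorem fiber_mem {j : J} {m : ℕ} (hj : lvl j = m) {s : Set J} (hs : ∀ i ∈ s, m ≤ lvl i)
    (hjs : j ∈ s) {X Z : C} (hX : X = N j ∨ R j X) (a : Z ⟶ D j) (f : D j ⟶ X)
    (b : X ⟶ Z⟦(1 : ℤ)⟧) (hT : Triangle.mk a f b ∈ distTriang C) (hf : f ≠ 0) :
    (dualLetter D s ∗ (belowLevel lvl N m ∗ excGE N R s 1)) Z := by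
  subst hj
  obtain ⟨c, hc⟩ := hp.exists_comparison j
  obtain ⟨q, rfl⟩ := (hp.comparison_bijective hc (hp.exc_mem_rightOrthogonal le_rfl hX)).2 f
  dsimp only at hT hf
  obtain ⟨K, k, k', hK, hKT⟩ := (trW_iff' _ _).1 hc
  have hq : q ≠ 0 := by
    rintro rfl
    simp at hf
  obtain rfl | hX := hX
  · obtain ⟨Q, l, l', hQ⟩ := distinguished_cocone_triangle₁ q
    have o := Triangulated.someOctahedron' rfl hK hQ hT
    refine le_extensionProduct_right _ Z (extensionProduct_of_distTriang _ o.mem hKT ?_)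
    -- The fibre of `q` is its cone shifted by -1: reductions in degree 0 land in T^{≥1}.
    have hQ' := hp.cone_mem j _ q _ _ (rot_of_distTriang _ hQ) hq
    refine prop_of_iso _ ((shiftEquiv C (1 : ℤ)).unitIso.symm.app Q) ?_
    refine extClosure_shift (-1) (fun B hB => ?_) hQ'
    exact extClosure.of _ ⟨j, hjs, -1, le_rfl, B, Or.inr hB, ⟨Iso.refl _⟩⟩
  · obtain hX | ⟨p, g, h, hB, -, hB'⟩ := hp.reduction j X hX
    · exact absurd (hX.eq_of_tgt _ _) hf
    · obtain hq' | ⟨u, rfl⟩ := hB' q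
      · exact absurd hq' hq
      -- Up to the automorphism `u`, the map is the projection onto the reduction, so its fibre is
      -- `N j`, an extension of a lower-level object by `D j`.
      have hQ : Triangle.mk (p ≫ u.inv) (u.hom ≫ g) h ∈ distTriang C :=
        distinguished_of_isos hB (Iso.refl _) u (Iso.refl _) (by simp) (by simp) (by simp)
      have o := Triangulated.someOctahedron' rfl hK hQ hT
      have hZ : (belowLevel lvl N (lvl j) ∗ (dualLetter D s ∗ belowLevel lvl N (lvl j))) Z :=
        extensionProduct_of_distTriang _ o.mem hKT (hp.exc_mem_dual_extensionProduct rfl hjs)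
      refine extensionProduct_mono le_rfl (le_extensionProduct_left _) Z ?_
      refine extensionProduct_mono le_rfl (extensionProduct_self_le (P := belowLevel lvl N (lvl j)))
        Z ?_
      rw [← extensionProduct_assoc]
      rw [← extensionProduct_assoc] at hZ
      exact extensionProduct_mono (hp.belowLevel_dualLE_swap hs (dualLetter_le s)) le_rfl Z hZ

theorem excGen_dualLetter_le {m : ℕ} {s : Set J} (hs : ∀ i ∈ s, lvl i = m) :
    excGen N R s 1 ∗ dualLetter D s ≤
      dualLetter D s ∗ (belowLevel lvl N m ∗ excGE N R s 1) := by
  have hexc : excGE N R s 1 ≤ belowLevel lvl N m ∗ excGE N R s 1 := le_extensionProduct_right _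
  rintro Z ⟨V, U, f, g, k, hT, hV, hU⟩
  by_cases hk : k = 0
  · exact extensionProduct_mono le_rfl ((le_extClosure _).trans hexc) Z
      (extensionProduct_swap_of_zero _ hT hV hU hk)
  obtain ⟨j, hj, n, hn, B, hB, ⟨e⟩⟩ := hV
  obtain hU | ⟨i, hi, n', hn', ⟨e'⟩⟩ := hU
  · exact absurd (hU.eq_of_src _ _) hk
  have e'' : V⟦(1 : ℤ)⟧ ≅ B⟦n + 1⟧ :=
    (shiftFunctor C 1).mapIso e ≪≫ (shiftFunctorAdd' C n 1 (n + 1) rfl).symm.app B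
  -- A nonzero connecting map needs n' = n + 1; as n ≤ -1 and n' ≥ 0, this leaves only n = -1 and n'
  -- = 0.
  by_cases h : i = j ∧ n + 1 - n' = 0
  · obtain ⟨rfl, h⟩ := h
    obtain rfl : n' = 0 := by lia
    obtain rfl : n = -1 := by lia
    let α : U ≅ D i := e' ≪≫ (shiftFunctorZero C ℤ).app (D i)
    let β : V⟦(1 : ℤ)⟧ ≅ B := e'' ≪≫ (shiftFunctorZero C ℤ).app B
    have hrot : Triangle.mk g k (-f⟦(1 : ℤ)⟧') ∈ distTriang C := rot_of_distTriang _ hT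
    have hT' : Triangle.mk (g ≫ α.hom) (α.inv ≫ k ≫ β.hom) (β.inv ≫ (-f⟦(1 : ℤ)⟧')) ∈
        distTriang C :=
      distinguished_of_isos hrot (Iso.refl _) α.symm β.symm
        (by simp) (by simp) (by simp)
    refine hp.fiber_mem (hs i hi) (fun i hi => (hs i hi).ge) hj hB _ _ _ hT' fun h0 => hk ?_
    rw [← cancel_epi α.inv, ← cancel_mono β.hom, Category.assoc, h0, comp_zero, zero_comp]
  · refine absurd (hom_eq_zero_of_isos e' e'' (hom_shift_eq_zero (c := n + 1 - n') (by simp)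
      fun f => ?_) k) hk
    exact hp.hom_dual_exc' h hB f

/-- Two inductions. One dual letter is first moved left past a whole word of exceptional letters; it
remains at most one letter, which is why `dualLetter` is not closed under extensions. Then words of
dual letters are treated. -/
theorem excGE_dualLE_le {m : ℕ} {s : Set J} (hs : ∀ i ∈ s, lvl i = m) :
    excGE N R s 1 ∗ dualLE D s 0 ≤
      dualLE D s 0 ∗ (belowLevel lvl N m ∗ excGE N R s 1) := by
  have hs' : ∀ i ∈ s, m ≤ lvl i := fun i hi => (hs i hi).ge
  have hexc : excGE N R s 1 ≤ belowLevel lvl N m ∗ excGE N R s 1 := le_extensionProduct_right _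
  have hletter : excGE N R s 1 ∗ dualLetter D s ≤
      dualLetter D s ∗ (belowLevel lvl N m ∗ excGE N R s 1) := by
    refine extClosure_extensionProduct_le (hp.excGen_dualLetter_le hs)
      (le_extensionProduct_left _) fun V hV => ?_
    exact (extensionProduct_absorb_left hV).trans
      (extensionProduct_pair_le (hp.excGE_belowLevel_swap hs' 1))
  refine extensionProduct_extClosure_le ?_ (hexc.trans (le_extensionProduct_right _))
    fun V hV => ?_
  · exact ((extensionProduct_mono le_rfl fun X hX => Or.inr hX).trans hletter).trans
      (extensionProduct_mono (dualLetter_le s) le_rfl)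
  · rw [extensionProduct_assoc, extensionProduct_assoc]
    exact (extensionProduct_mono le_rfl ((extensionProduct_mono le_rfl hV).trans
      (middle_extensionProduct_triple_le (hp.belowLevel_dualLE_swap hs' le_rfl)))).trans
      extensionProduct_self_left_le

theorem belowLevel_succ_le (m : ℕ) :
    belowLevel lvl N (m + 1) ≤ dualLE D {j | lvl j = m} 0 ∗
      (belowLevel lvl N m ∗ excGE N R {j | lvl j = m} 1) := by
  have hs : ∀ i ∈ {j | lvl j = m}, m ≤ lvl i := fun i hi => (Set.mem_ofPred.1 hi).ge
  have := extensionProduct_triple_isTriangulatedClosed₂ (hp.belowLevel_dualLE_swap hs le_rfl)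
    (hp.excGE_belowLevel_swap hs 1) (hp.excGE_dualLE_le fun i hi => hi)
  refine triClosure_le_of_shift ?_
  rintro _ ⟨j, hj, rfl⟩ n
  obtain hj | hj := Nat.lt_succ_iff_lt_or_eq.1 hj
  · exact le_extensionProduct_right _ _ (le_extensionProduct_left _ _
      (le_shift _ n _ (mem_belowLevel hj)))
  -- Negative shifts of `N j` already lie in T^{≥1}; for the others, the shifted comparison triangle
  -- exhibits an element of 𝓓 ∗ T_{<m}.
  · obtain hn | hn := lt_or_ge n 0
    · exact le_extensionProduct_right _ _ (le_extensionProduct_right _ _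
        (extClosure.of _ ⟨j, hj, n, by lia, N j, Or.inl rfl, ⟨Iso.refl _⟩⟩))
    · refine extensionProduct_mono le_rfl (le_extensionProduct_left _) _ ?_
      obtain ⟨c, Z, g, h, hT, hZ⟩ := hp.exists_comparison j
      exact extensionProduct_of_distTriang _ (Triangle.shift_distinguished _ hT n)
        (extClosure.of _ ⟨j, hj, n, by lia, ⟨Iso.refl _⟩⟩) (le_shift _ n _ (hj ▸ hZ))

theorem belowLevel_le_truncation (m : ℕ) :
    belowLevel lvl N m ≤ dualLE D {j | lvl j < m} 0 ∗ excGE N R {j | lvl j < m} 1 := by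
  induction m with
  | zero =>
    refine (triClosure_le_of_shift ?_).trans (le_extensionProduct_left _)
    rintro _ ⟨j, hj, -⟩
    simp at hj
  | succ m ih =>
    refine (hp.belowLevel_succ_le m).trans ?_
    refine (extensionProduct_mono le_rfl (extensionProduct_mono ih le_rfl)).trans ?_
    rw [extensionProduct_assoc, ← extensionProduct_assoc]
    have h₁ : {j | lvl j = m} ⊆ {j | lvl j < m + 1} := fun j hj => by
      simp only [Set.mem_ofPred_eq] at hj ⊢; lia
    have h₂ : {j | lvl j < m} ⊆ {j | lvl j < m + 1} := fun j hj => by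
      simp only [Set.mem_ofPred_eq] at hj ⊢; lia
    exact extensionProduct_mono
      ((extensionProduct_mono (dualLE_mono D h₁ le_rfl) (dualLE_mono D h₂ le_rfl)).trans
        extensionProduct_self_le)
      ((extensionProduct_mono (excGE_mono N R h₂ le_rfl) (excGE_mono N R h₁ le_rfl)).trans
        extensionProduct_self_le)

theorem hom_dualLE_excGE {s s' : Set J} {a b : ℤ} (hab : a < b) {X Y : C}
    (hX : dualLE D s a X) (hY : excGE N R s' b Y) (f : X ⟶ Y) : f = 0 := by
  have h : dualLE D s a ≤ (excGE N R s' b).leftOrthogonal := by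
    refine extClosure_le ?_
    rintro X ⟨i, -, n, hn, ⟨e⟩⟩
    suffices excGE N R s' b ≤ rightOrthogonal (fun Z => Z = X) from
      fun Z f hZ => this Z hZ f rfl
    refine extClosure_le ?_
    rintro Y ⟨j, -, n', hn', B, hB, ⟨e'⟩⟩ _ f rfl
    refine hom_eq_zero_of_isos e e' (hom_shift_eq_zero (c := n' - n) (by simp)
      fun f => ?_) f
    exact hp.hom_dual_exc' (by lia) hB f
  exact h X hX f hY

/-- The t-structure whose aisle is generated under extensions by the `D j[n]` with `n ≥ 0`. -/
def tStructure : Triangulated.TStructure C where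
  le := dualLE D Set.univ
  ge := excGE N R Set.univ
  le_shift n a n' h X hX := dualLE_shift D _ n a n' h X hX
  ge_shift n a n' h X hX := excGE_shift N R _ n a n' h X hX
  zero' X Y f hX hY := hp.hom_dualLE_excGE zero_lt_one hX hY f
  le_zero_le := dualLE_mono D le_rfl zero_le_one
  ge_one_le := excGE_mono N R le_rfl zero_le_one
  exists_triangle_zero_one A := by
    obtain ⟨m, hm⟩ := hp.generates A
    obtain ⟨X, Y, f, g, h, hT, hX, hY⟩ := hp.belowLevel_le_truncation m A hm
    exact ⟨X, Y, dualLE_mono D (Set.subset_univ _) le_rfl X hX,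
      excGE_mono N R (Set.subset_univ _) le_rfl Y hY, f, g, h, hT⟩

end IsDualPair

end Truncation

/-! ### The heart as an abelian category, and its short exact sequences. -/

section Heart

variable {C : Type u} [Category.{v} C] [Preadditive C] [HasZeroObject C] [HasShift C ℤ]
  [∀ n : ℤ, (shiftFunctor C n).Additive] [Pretriangulated C]
  (t : Triangulated.TStructure C)

instance heart_containsZero : t.heart.ContainsZero where
  exists_zero := ⟨0, isZero_zero C, (t.mem_heart_iff _).2
    ⟨t.isLE_of_isZero (isZero_zero C) 0, t.isGE_of_isZero (isZero_zero C) 0⟩⟩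

instance heart_isTriangulatedClosed₂ : t.heart.IsTriangulatedClosed₂ :=
  .mk' fun T hT h₁ h₃ => by
    rw [t.mem_heart_iff] at h₁ h₃ ⊢
    exact ⟨t.isLE₂ T hT 0 h₁.1 h₃.1, t.isGE₂ T hT 0 h₁.2 h₃.2⟩

instance heart_isClosedUnderBinaryProducts : t.heart.IsClosedUnderBinaryProducts where
  limitsOfShape_le := by
    rintro X ⟨p⟩
    refine t.heart.prop_of_iso ?_ (t.heart.ext_of_isTriangulatedClosed₂ _
      (binaryProductTriangle_distinguished _ _)
      (p.prop_diag_obj (.mk .left)) (p.prop_diag_obj (.mk .right)))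
    exact IsLimit.conePointUniqueUpToIso (prodIsProd _ _)
      ((IsLimit.postcomposeHomEquiv (diagramIsoPair p.diag) _).2 p.isLimit)

instance heart_isClosedUnderFiniteProducts : t.heart.IsClosedUnderFiniteProducts := .mk'

theorem heart_hom_eq_zero ⦃X Y : t.heart.FullSubcategory⦄ ⦃n : ℤ⦄
    (f : t.heart.ι.obj X ⟶ (t.heart.ι.obj Y)⟦n⟧) (hn : n < 0) : f = 0 := by
  have hX := (t.mem_heart_iff _).1 X.property
  have hY := (t.mem_heart_iff _).1 Y.property
  have := hX.1
  have := hY.2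
  have : t.IsGE ((t.heart.ι.obj Y)⟦n⟧) (-n) := t.isGE_shift Y.obj 0 n (-n)
  exact t.zero_of_isLE_of_isGE f 0 (-n) (by lia) hX.1 this

/-- The cone of a morphism of the heart lives in degrees -1 and 0. Its truncation triangle has the
shifted kernel and the cokernel as outer terms. -/
theorem heart_admissibleMorphism :
    Triangulated.AbelianSubcategory.admissibleMorphism t.heart.ι = ⊤ := by
  refine top_unique fun X₁ X₂ f₁ _ X₃ f₂ f₃ hT => ?_
  have h₁ := (t.mem_heart_iff _).1 X₁.property
  have h₂ := (t.mem_heart_iff _).1 X₂.property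
  obtain ⟨_, _⟩ := h₁
  obtain ⟨_, _⟩ := h₂
  have hrot := rot_of_distTriang _ hT
  have hle : t.IsLE (X₁.obj⟦(1 : ℤ)⟧) (-1) := t.isLE_shift X₁.obj 0 1 (-1)
  have hge : t.IsGE (X₁.obj⟦(1 : ℤ)⟧) (-1) := t.isGE_shift X₁.obj 0 1 (-1)
  have hle₃ : t.IsLE X₃ 0 := t.isLE₂ _ hrot 0 ‹_› (t.isLE_of_le (X₁.obj⟦(1 : ℤ)⟧) (-1) 0)
  have hge₃ : t.IsGE X₃ (-1) := t.isGE₂ _ hrot (-1) (t.isGE_of_ge X₂.obj (-1) 0) hge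
  obtain ⟨A, B, hA, hB, a, b, c, hABC⟩ := t.exists_triangle X₃ (-1) 0 (by simp)
  rw [t.le_iff_isLE] at hA
  rw [t.ge_iff_isGE] at hB
  have hB₁ : t.IsGE (B⟦(-1 : ℤ)⟧) 1 := t.isGE_shift B 0 (-1) 1
  have hA₁ : t.IsLE (A⟦(1 : ℤ)⟧) (-2) := t.isLE_shift A (-1) 1 (-2)
  have hA' : t.IsGE A (-1) := t.isGE₂ _ (inv_rot_of_distTriang _ hABC) (-1)
    (t.isGE_of_ge (B⟦(-1 : ℤ)⟧) (-1) 1) hge₃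
  have hB' : t.IsLE B 0 := t.isLE₂ _ (rot_of_distTriang _ hABC) 0 hle₃
    (t.isLE_of_le (A⟦(1 : ℤ)⟧) (-2) 0)
  have hK : t.heart (A⟦(-1 : ℤ)⟧) := (t.mem_heart_iff _).2
    ⟨t.isLE_shift A (-1) (-1) 0, t.isGE_shift A (-1) (-1) 0⟩
  have hQ : t.heart B := (t.mem_heart_iff _).2 ⟨hB', hB⟩
  let e : A⟦(-1 : ℤ)⟧⟦(1 : ℤ)⟧ ≅ A := (shiftEquiv C (1 : ℤ)).counitIso.app A
  refine ⟨⟨_, hK⟩, ⟨B, hQ⟩, e.hom ≫ a, b, c ≫ e.inv⟦(1 : ℤ)⟧', ?_⟩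
  exact distinguished_of_isos hABC e (Iso.refl _) (Iso.refl _) (by simp) (by simp)
    (by rw [Category.assoc, ← Functor.map_comp]; simp)

variable [IsTriangulated C]

/-- The heart of a t-structure is an abelian category. -/
@[reducible]
noncomputable def heartAbelian : Abelian t.heart.FullSubcategory :=
  Triangulated.AbelianSubcategory.abelian t.heart.ι (heart_hom_eq_zero t)
    (heart_admissibleMorphism t)

attribute [local instance] heartAbelian

theorem heart_exists_distTriang_of_shortExact (S : ShortComplex t.heart.FullSubcategory)
    (hS : S.ShortExact) :
    ∃ δ : S.X₃.obj ⟶ S.X₁.obj⟦(1 : ℤ)⟧, Triangle.mk S.f.hom S.g.hom δ ∈ distTriang C := by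
  have := hS.epi_g
  have := hS.mono_f
  obtain ⟨K, i, δ, hT⟩ := Triangulated.AbelianSubcategory.exists_distinguished_triangle_of_epi
    (heart_hom_eq_zero t) (heart_admissibleMorphism t) S.g
  let e : K ≅ S.X₁ := IsLimit.conePointUniqueUpToIso
    (Triangulated.AbelianSubcategory.isLimitKernelForkOfDistTriang (heart_hom_eq_zero t) _ _ _ hT)
    hS.fIsKernel
  have he : e.hom ≫ S.f = i :=
    IsLimit.conePointUniqueUpToIso_hom_comp _ hS.fIsKernel WalkingParallelPair.zero
  let e' : S.X₁.obj ≅ K.obj := t.heart.ι.mapIso e.symm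
  have he' : S.f.hom = e'.hom ≫ i.hom := by
    have : S.f = e.inv ≫ i := by rw [← he, e.inv_hom_id_assoc]
    exact congrArg (fun φ => φ.hom) this
  refine ⟨δ ≫ e'.inv⟦(1 : ℤ)⟧', distinguished_of_isos hT e' (Iso.refl _) (Iso.refl _) ?_ ?_ ?_⟩
  · simpa using he'
  · simp
  · rw [Category.assoc, ← Functor.map_comp]; simp

end Heart

/-! ### Noetherianity of an abelian category from functors that detect a filtration. -/

section NoetherianFiltration

variable {A : Type u} [Category.{v} A] [Abelian A]

/-- The sequence of kernels of a composition `a ≫ b` with `a` epi. -/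
@[reducible]
noncomputable def kernelCompSequence {X Y Z : A} (a : X ⟶ Y) (b : Y ⟶ Z) : ShortComplex A :=
  ShortComplex.mk (kernel.lift (a ≫ b) (kernel.ι a) (by simp))
    (kernel.lift b (kernel.ι (a ≫ b) ≫ a) (by simp)) (by ext; simp)

theorem kernelCompSequence_shortExact {X Y Z : A} (a : X ⟶ Y) (b : Y ⟶ Z) [Epi a] :
    (kernelCompSequence a b).ShortExact where
  mono_f := mono_of_mono_fac (kernel.lift_ι (a ≫ b) (kernel.ι a) _)
  epi_g := by
    rw [epi_iff_surjective_up_to_refinements]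
    intro W y
    obtain ⟨W', π, hπ, x, hx⟩ := surjective_up_to_refinements_of_epi a (y ≫ kernel.ι b)
    refine ⟨W', π, hπ, kernel.lift (a ≫ b) x ?_, ?_⟩
    · rw [← Category.assoc, ← hx]
      simp
    · ext
      simpa using hx
  exact := by
    have : Mono (kernelCompSequence a b).f :=
      mono_of_mono_fac (kernel.lift_ι (a ≫ b) (kernel.ι a) _)
    refine ShortComplex.exact_of_f_is_kernel _ (KernelFork.IsLimit.ofι' _ _ fun {W} k hk => ?_)
    have hk' : (k ≫ kernel.ι (a ≫ b)) ≫ a = 0 := by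
      have := congrArg (· ≫ kernel.ι b) hk
      simpa using this
    refine ⟨kernel.lift a (k ≫ kernel.ι (a ≫ b)) hk', ?_⟩
    ext
    simp

theorem map_map_apply (G : A ⥤ AddCommGrpCat.{w}) {X Y Z : A} {f : X ⟶ Y} {g : Y ⟶ Z} {h : X ⟶ Z}
    (e : f ≫ g = h) (x : G.obj X) : G.map g (G.map f x) = G.map h x := by
  rw [← e, Functor.map_comp, ConcreteCategory.comp_apply]

/-- Functors `G j`, layered by `lvl`, detecting the steps of an exhaustive filtration `P` of an
abelian category, and whose values satisfy an ascending chain condition. -/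
structure IsNoetherianFiltration {J : Type w'} (lvl : J → ℕ) (G : J → A ⥤ AddCommGrpCat.{w})
    (P : ℕ → ObjectProperty A) : Prop where
  zero : ∀ X, P 0 X → IsZero X
  exists_mem : ∀ X, ∃ m, P m X
  mono : ∀ m, P m ≤ P (m + 1)
  injective : ∀ S : ShortComplex A, S.ShortExact → ∀ j, Function.Injective ((G j).map S.f)
  surjective : ∀ S : ShortComplex A, S.ShortExact → ∀ j, P (lvl j + 1) S.X₁ →
    Function.Surjective ((G j).map S.g)
  drop : ∀ m X, P (m + 1) X → (∀ j, lvl j = m → ∀ x : (G j).obj X, x = 0) → P m X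
  vanish : ∀ m X, P m X → ∀ j, m ≤ lvl j → ∀ x : (G j).obj X, x = 0
  quotient : ∀ S : ShortComplex A, S.ShortExact → ∀ m, P m S.X₁ → P m S.X₂ → P m S.X₃
  stable : ∀ (m : ℕ) (X : A) (Q : ℕ → A) (g : ∀ n, X ⟶ Q n),
    (∀ n, ∃ h : Q n ⟶ Q (n + 1), g (n + 1) = g n ≫ h) →
    ∃ n₀, ∀ n ≥ n₀, ∀ j, lvl j = m → ∀ y : (G j).obj X,
      (G j).map (g n) y = 0 → (G j).map (g n₀) y = 0

namespace IsNoetherianFiltration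

variable {J : Type w'} {lvl : J → ℕ} {G : J → A ⥤ AddCommGrpCat.{w}}
  {P : ℕ → ObjectProperty A} [∀ j, (G j).PreservesZeroMorphisms]
  (hP : IsNoetherianFiltration lvl G P)

include hP

/-- The detecting functors of level at least m vanish on the middle term, hence on the subobject,
whose level can then be lowered step by step to m. -/
theorem subobject (S : ShortComplex A) (hS : S.ShortExact) (m : ℕ) (h : P m S.X₂) :
    P m S.X₁ := by
  obtain ⟨M, hM⟩ := hP.exists_mem S.X₁
  obtain hMm | hmM := le_total M m
  · exact monotone_nat_of_le_succ hP.mono hMm _ hM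
  · induction M, hmM using Nat.le_induction with
    | base => exact hM
    | succ k hk ih =>
      refine ih (hP.drop k _ hM fun j hj x => hP.injective S hS j ?_)
      rw [map_zero]
      exact hP.vanish m _ h j (by lia) _

/-- Going far enough along a sequence of epimorphisms removes the top level of all later kernels. At
m = 0 these kernels vanish. -/
theorem exists_kernel_mem (Q : ℕ ⥤ A) (hQ : ∀ {n n' : ℕ} (f : n ⟶ n'), Epi (Q.map f)) (m M : ℕ)
    (hM : P M (Q.obj 0)) (hmM : m ≤ M) :
    ∃ n₀ : ℕ, ∀ (n : ℕ) (f : n₀ ⟶ n), P m (kernel (Q.map f)) := by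
  induction hmM using Nat.decreasingInduction with
  | self =>
    refine ⟨0, fun n f => ?_⟩
    have := hQ f
    exact hP.subobject (ShortComplex.mk (kernel.ι (Q.map f)) (Q.map f) (by simp))
      { exact := ShortComplex.exact_of_f_is_kernel _ (kernelIsKernel _) } M hM
  | of_succ m hm ih =>
    obtain ⟨n₀, hn₀⟩ := ih
    obtain ⟨n₁, hn₁⟩ := hP.stable m (Q.obj n₀) (fun i => Q.obj (n₀ + i))
      (fun i => Q.map (homOfLE (Nat.le_add_right n₀ i)))
      (fun i => ⟨Q.map (homOfLE (by lia)), by rw [← Q.map_comp]; rfl⟩)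
    refine ⟨n₀ + n₁, fun n f => ?_⟩
    obtain ⟨i, rfl⟩ := Nat.exists_eq_add_of_le ((Nat.le_add_right n₀ n₁).trans (leOfHom f))
    let a := Q.map (homOfLE (Nat.le_add_right n₀ n₁))
    let b := Q.map f
    have : Epi a := hQ _
    have : Epi b := hQ _
    have hab : a ≫ b = Q.map (homOfLE ((Nat.le_add_right n₀ n₁).trans (leOfHom f))) := by
      rw [← Q.map_comp]
      rfl
    have hS := kernelCompSequence_shortExact a b
    have hb : (ShortComplex.mk (kernel.ι b) b (by simp)).ShortExact :=
      { exact := ShortComplex.exact_of_f_is_kernel _ (kernelIsKernel _) }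
    have ha : P (m + 1) (kernel a) := hn₀ _ _
    have hc : P (m + 1) (kernel (a ≫ b)) := by
      rw [hab]
      exact hn₀ _ _
    refine hP.drop m _ (hP.quotient _ hS (m + 1) ha hc) fun j hj x => ?_
    -- Lift `x` to the kernel of `a ≫ b`. The lift dies in `Q.obj (n₀ + i)`, hence by stability
    -- already under `a`; so `x` has zero image in the source of `b`, and injectivity gives `x = 0`.
    obtain ⟨z, rfl⟩ := hP.surjective _ hS j (by rw [hj]; exact ha) x
    refine hP.injective _ hb j ?_
    rw [map_zero]
    have h₁ := hn₁ i (by have := leOfHom f; lia) j hj ((G j).map (kernel.ι (a ≫ b)) z) (by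
      rw [map_map_apply (G j) (h := 0) (by rw [← hab, kernel.condition]), Functor.map_zero]
      rfl)
    exact (map_map_apply (G j) (kernel.lift_ι b (kernel.ι (a ≫ b) ≫ a) (by simp)) z).trans
      ((map_map_apply (G j) rfl z).symm.trans h₁)

/-- An abelian category with a noetherian filtration is noetherian. -/
theorem isNoetherianObject (X : A) : IsNoetherianObject X := by
  rw [isNoetherianObject_iff_monotone_chain_condition]
  intro f
  -- The ascending chain of subobjects is turned into a sequence of quotients of X.
  let Q : ℕ ⥤ A :=
    { obj := fun n => cokernel (f n).arrow
      map := fun {n n'} h => cokernel.desc _ (cokernel.π (f n').arrow) (by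
        rw [← Subobject.ofLE_arrow (f.monotone (leOfHom h)), Category.assoc,
          cokernel.condition, comp_zero])
      map_id := fun n => by ext; simp
      map_comp := fun h h' => by ext; simp }
  have hπ : ∀ {n n' : ℕ} (h : n ⟶ n'),
      cokernel.π (f n).arrow ≫ Q.map h = cokernel.π (f n').arrow := fun h =>
    cokernel.π_desc _ _ _
  have hQ : ∀ {n n' : ℕ} (h : n ⟶ n'), Epi (Q.map h) := fun h => epi_of_epi_fac (hπ h)
  obtain ⟨M, hM⟩ := hP.exists_mem (Q.obj 0)
  obtain ⟨n₀, hn₀⟩ := hP.exists_kernel_mem Q hQ 0 M hM (Nat.zero_le M)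
  refine ⟨n₀, fun n hn => le_antisymm (f.monotone hn) ?_⟩
  have : Mono (Q.map (homOfLE hn)) :=
    Preadditive.mono_of_isZero_kernel _ (hP.zero _ (hn₀ n (homOfLE hn)))
  have h0 : (f n).arrow ≫ cokernel.π (f n₀).arrow = 0 := by
    rw [← cancel_mono (Q.map (homOfLE hn)), Category.assoc, hπ, cokernel.condition, zero_comp]
  exact Subobject.le_of_comm (Abelian.monoLift (f n₀).arrow _ h0) (Abelian.monoLift_comp _ _ _)

end IsNoetherianFiltration

end NoetherianFiltration

/-! ### Detecting functors on the heart, for both chain conditions. -/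

section ChainConditions

open Opposite

variable {C : Type u} [Category.{v} C] [Preadditive C] [HasZeroObject C] [HasShift C ℤ]
  [∀ n : ℤ, (shiftFunctor C n).Additive] [Pretriangulated C]
  {J : Type w'} {lvl : J → ℕ} {N D : J → C} {R : J → ObjectProperty C}

local infixr:70 " ∗ " => ObjectProperty.extensionProduct

theorem isZero_obj₃_of_hom_eq_zero (T : Triangle C) (hT : T ∈ distTriang C)
    (h₂ : ∀ f : T.obj₂ ⟶ T.obj₃, f = 0) (h₁ : ∀ f : T.obj₁⟦(1 : ℤ)⟧ ⟶ T.obj₃, f = 0) :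
    IsZero T.obj₃ := by
  obtain ⟨y, hy⟩ := Triangle.yoneda_exact₃ T hT (𝟙 _) (h₂ _)
  rw [IsZero.iff_id_eq_zero, hy, h₁ y, comp_zero]

theorem isZero_obj₁_of_hom_eq_zero (T : Triangle C) (hT : T ∈ distTriang C)
    (h₂ : ∀ f : T.obj₁ ⟶ T.obj₂, f = 0) (h₃ : ∀ f : T.obj₁ ⟶ T.obj₃⟦(-1 : ℤ)⟧, f = 0) :
    IsZero T.obj₁ := by
  rw [IsZero.iff_id_eq_zero]
  exact eq_zero_of_comp_mor₁_eq_zero T hT _ (h₂ _) h₃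

theorem hom_eq_zero_of_hom_shift_eq_zero {X Y : C} {n : ℤ} (h : ∀ f : X⟦-n⟧ ⟶ Y, f = 0)
    (f : X ⟶ Y⟦n⟧) : f = 0 := by
  apply (shiftFunctor C (-n)).map_injective
  rw [Functor.map_zero]
  exact hom_eq_zero_of_isos (Iso.refl _) ((shiftEquiv C n).unitIso.symm.app Y) h _

variable [IsTriangulated C]

/-- An object of `belowLevel (m + 1)` without morphisms to the shifts of the `N j` of level `m`
lies in `belowLevel m`. -/
theorem mem_belowLevel_of_hom_exc_eq_zero
    (hN : ∀ (i j : J) (n : ℤ) (f : N i ⟶ (N j)⟦n⟧), lvl i < lvl j → f = 0)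
    {m : ℕ} {X : C} (hX : belowLevel lvl N (m + 1) X)
    (h : ∀ Y, triClosure (fun Z => ∃ j, lvl j = m ∧ Z = N j) Y → 
      (belowLevel lvl N m).rightOrthogonal Y → ∀ f : X ⟶ Y, f = 0) :
    belowLevel lvl N m X := by
  let 𝒩 : ObjectProperty C := triClosure fun Z => ∃ j, lvl j = m ∧ Z = N j
  have h𝒩 : 𝒩 ≤ (belowLevel lvl N m).rightOrthogonal := by
    refine triClosure_le ?_
    rintro _ ⟨j, hj, rfl⟩ Y f hY
    exact hom_belowLevel_eq_zero hN hj.ge hY f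
  have hswap : 𝒩 ∗ belowLevel lvl N m ≤ belowLevel lvl N m ∗ 𝒩 :=
    extensionProduct_swap fun Y Z hY hZ f => (le_shift _ 1 _ (h𝒩 Z hZ)) f hY
  have := extensionProduct_isTriangulatedClosed₂ hswap
  have hle : belowLevel lvl N (m + 1) ≤ belowLevel lvl N m ∗ 𝒩 := by
    refine triClosure_le_of_shift ?_
    rintro _ ⟨j, hj, rfl⟩ n
    obtain hj | hj := Nat.lt_succ_iff_lt_or_eq.1 hj
    · exact le_extensionProduct_left _ _ (le_shift _ n _ (IsDualPair.mem_belowLevel hj))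
    · exact le_extensionProduct_right _ _
        (triClosure.shift _ n (triClosure.of _ ⟨j, hj, rfl⟩))
  obtain ⟨L, B, f, g, k, hT, hL, hB⟩ := hle X hX
  -- Since X → B vanishes, the identity of B factors through L[1], which has no maps to B.
  have hB0 : IsZero B := isZero_obj₃_of_hom_eq_zero _ hT (h B hB (h𝒩 B hB))
    (fun y => h𝒩 B hB y (le_shift _ 1 _ hL))
  have : IsIso f := (Triangle.isZero₃_iff_isIso₁ _ hT).1 hB0
  exact prop_of_iso _ (asIso f) hL

namespace IsDualPair

variable (hp : IsDualPair lvl N D R)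

include hp

/-- The truncation triangle can be built inside level less than m, and for an object of the aisle
its second part vanishes. -/
theorem dualLE_of_belowLevel {m : ℕ} {X : C} (hX : dualLE D Set.univ 0 X)
    (hX' : belowLevel lvl N m X) : dualLE D {j | lvl j < m} 0 X := by
  obtain ⟨A, B, f, g, k, hT, hA, hB⟩ := hp.belowLevel_le_truncation m X hX'
  have hB0 : IsZero B := isZero_obj₃_of_hom_eq_zero _ hT
    (hp.hom_dualLE_excGE zero_lt_one hX hB)
    (hp.hom_dualLE_excGE (by simp) (dualLE_shift D _ 0 1 (-1) (by simp) A hA) hB)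
  have : IsIso f := (Triangle.isZero₃_iff_isIso₁ _ hT).1 hB0
  exact prop_of_iso _ (asIso f) hA

theorem excGE_of_belowLevel {m : ℕ} {X : C} (hX : excGE N R Set.univ 1 X)
    (hX' : belowLevel lvl N m X) : excGE N R {j | lvl j < m} 1 X := by
  obtain ⟨A, B, f, g, k, hT, hA, hB⟩ := hp.belowLevel_le_truncation m X hX'
  have hA0 : IsZero A := isZero_obj₁_of_hom_eq_zero _ hT
    (hp.hom_dualLE_excGE zero_lt_one hA hX)
    (hp.hom_dualLE_excGE (by simp) hA (excGE_shift N R _ 1 (-1) 2 (by simp) B hB))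
  have : IsIso g := (Triangle.isZero₁_iff_isIso₂ _ hT).1 hA0
  exact prop_of_iso _ (asIso g).symm hB

/-- The comparison map replaces the target by `N i`, since its cone has level below that of j and
receives nothing from `D j`. -/
theorem hom_dual_dual {i j : J} (hij : lvl i ≤ lvl j) {n : ℤ} (hn : n ≠ 0)
    (f : D j ⟶ (D i)⟦n⟧) : f = 0 := by
  obtain ⟨c, Z, g, h, hT, hZ⟩ := hp.exists_comparison i
  refine eq_zero_of_comp_mor₁_eq_zero _ (Triangle.shift_distinguished _ hT n) f ?_ fun y => ?_
  · exact hp.hom_dual_exc (fun h => hn h.2) _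
  · exact hp.hom_dual_belowLevel hij (le_shift _ (-1) _ (le_shift _ n _ hZ)) y

theorem hom_dual_dualLE {j : J} {s : Set J} (hs : ∀ i ∈ s, lvl i ≤ lvl j) {X : C}
    (hX : dualLE D s (-1) X) (f : D j ⟶ X) : f = 0 := by
  have : dualLE D s (-1) ≤ rightOrthogonal (fun Z => Z = D j) := by
    refine extClosure_le ?_
    rintro X ⟨i, hi, n, hn, ⟨e⟩⟩ _ f rfl
    exact hom_eq_zero_of_isos (Iso.refl _) e (hp.hom_dual_dual (hs i hi) (by lia)) f
  exact this X hX f rfl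

/-- Vanishing reductions are essential: the triangle of a nonzero reduction B of `N j` gives a
nonzero map B[-1] → N j when N j → B is not surjective on Hom(B, -). -/
theorem hom_excGE_exc (hR : ∀ j B, R j B → IsZero B) {j : J} {s : Set J}
    (hs : ∀ i ∈ s, lvl i ≤ lvl j) {X : C} (hX : excGE N R s 1 X) (f : X ⟶ N j) : f = 0 := by
  have : excGE N R s 1 ≤ leftOrthogonal (fun Z => Z = N j) := by
    refine extClosure_le ?_
    rintro X ⟨i, hi, n, hn, B, hB, ⟨e⟩⟩ _ f rfl
    obtain rfl | hB := hB
    · refine hom_eq_zero_of_isos e ((shiftFunctorZero C ℤ).symm.app (N j))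
        (hom_shift_eq_zero (c := -n) (by simp) fun f => ?_) f
      exact hp.hom_eq_zero i j _ f (hs i hi) (by lia)
    · exact (((shiftFunctor C n).map_isZero (hR i B hB)).of_iso e).eq_of_src _ _
  exact this X hX f rfl

theorem dual_mem_dualLE (j : J) : dualLE D Set.univ 0 (D j) :=
  extClosure.of _ ⟨j, Set.mem_univ j, 0, by simp, ⟨(shiftFunctorZero C ℤ).symm.app (D j)⟩⟩

theorem exc_mem_excGE (j : J) : excGE N R Set.univ 0 (N j) :=
  extClosure.of _ ⟨j, Set.mem_univ j, 0, by simp, N j, Or.inl rfl,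
    ⟨(shiftFunctorZero C ℤ).symm.app (N j)⟩⟩

/-- Relative projectivity: `D j` behaves like a projective object towards objects of level at most
its own. -/
theorem hom_dual_shift_eq_zero {m : ℕ} {X : C} (hX : dualLE D Set.univ 0 X)
    (hX' : belowLevel lvl N m X) {j : J} (hj : m ≤ lvl j + 1) {n : ℤ} (hn : 0 < n)
    (f : D j ⟶ X⟦n⟧) : f = 0 := by
  have h := dualLE_mono D subset_rfl (show -n ≤ -1 by lia)
    _ (dualLE_shift D _ 0 n (-n) (by simp) X (hp.dualLE_of_belowLevel hX hX'))
  refine hp.hom_dual_dualLE (fun i hi => ?_) h f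
  rw [Set.mem_ofPred_eq] at hi
  lia

/-- An object of the heart of level at most `m` without morphisms from the `D j` of level `m`
has level less than `m`. -/
theorem mem_belowLevel_of_hom_dual_eq_zero {m : ℕ} {X : C} (hX : belowLevel lvl N (m + 1) X)
    (hle : dualLE D Set.univ 0 X) (hge : excGE N R Set.univ 0 X)
    (h : ∀ j, lvl j = m → ∀ f : D j ⟶ X, f = 0) : belowLevel lvl N m X := by
  have h' : ∀ j, lvl j = m → ∀ (n : ℤ) (f : D j ⟶ X⟦n⟧), f = 0 := by
    intro j hj n f
    -- Negative degrees vanish by the t-structure, degree 0 by hypothesis, positive degrees by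
    -- relative projectivity.
    obtain hn | rfl | hn := lt_trichotomy n 0
    · exact hp.hom_dualLE_excGE (by lia) (dual_mem_dualLE hp j)
        (excGE_shift N R _ 0 n (-n) (by simp) X hge) f
    · exact hom_eq_zero_of_isos (Iso.refl _) ((shiftFunctorZero C ℤ).app X) (h j hj) f
    · exact hp.hom_dual_shift_eq_zero hle hX (by lia) hn f
  let 𝒟 : ObjectProperty C := triClosure fun Z => ∃ j, lvl j = m ∧ Z = D j
  have h𝒟 : 𝒟 ≤ (belowLevel lvl N m).leftOrthogonal := by
    refine triClosure_le ?_
    rintro _ ⟨j, hj, rfl⟩ Y f hY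
    exact hp.hom_dual_belowLevel hj.ge hY f
  have h𝒟X : 𝒟 ≤ leftOrthogonal (fun Z => Z = X) := by
    refine triClosure_le_of_shift ?_
    rintro _ ⟨j, hj, rfl⟩ n _ f rfl
    exact hom_eq_zero_of_isos (Iso.refl _) ((shiftFunctorZero C ℤ).symm.app _)
      (hom_shift_eq_zero (c := -n) (by simp) (h' j hj _)) f
  have hswap : belowLevel lvl N m ∗ 𝒟 ≤ 𝒟 ∗ belowLevel lvl N m :=
    extensionProduct_swap fun Y Z hY hZ f => h𝒟 Y hY f (le_shift _ 1 _ hZ)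
  have := extensionProduct_isTriangulatedClosed₂ hswap
  have hle : belowLevel lvl N (m + 1) ≤ 𝒟 ∗ belowLevel lvl N m := by
    refine triClosure_le_of_shift ?_
    rintro _ ⟨j, hj, rfl⟩ n
    obtain hj | hj := Nat.lt_succ_iff_lt_or_eq.1 hj
    · exact le_extensionProduct_right _ _ (le_shift _ n _ (IsDualPair.mem_belowLevel hj))
    · obtain ⟨c, Z, g, h, hT, hZ⟩ := hp.exists_comparison j
      exact extensionProduct_of_distTriang _ (Triangle.shift_distinguished _ hT n)
        (triClosure.shift _ n (triClosure.of _ ⟨j, hj, rfl⟩)) (le_shift _ n _ (hj ▸ hZ))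
  obtain ⟨A, L, f, g, k, hT, hA, hL⟩ := hle X hX
  have hA0 : IsZero A := isZero_obj₁_of_hom_eq_zero _ hT (fun y => h𝒟X A hA y rfl)
    (fun y => h𝒟 A hA y (le_shift _ (-1) _ hL))
  have : IsIso g := (Triangle.isZero₁_iff_isIso₂ _ hT).1 hA0
  exact prop_of_iso _ (asIso g).symm hL

theorem mem_belowLevel_of_hom_exc_eq_zero (hR : ∀ j B, R j B → IsZero B) {m : ℕ} {X : C}
    (hX : belowLevel lvl N (m + 1) X) (hle : dualLE D Set.univ 0 X)
    (hge : excGE N R Set.univ 0 X) (h : ∀ j, lvl j = m → ∀ f : X ⟶ N j, f = 0) :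
    belowLevel lvl N m X := by
  have h' : ∀ j, lvl j = m → ∀ (n : ℤ) (f : X ⟶ (N j)⟦n⟧), f = 0 := by
    intro j hj n f
    obtain hn | rfl | hn := lt_trichotomy n 0
    · exact hp.hom_dualLE_excGE (by lia) hle
        (excGE_shift N R _ 0 n (-n) (by simp) _ (hp.exc_mem_excGE j)) f
    · exact hom_eq_zero_of_isos (Iso.refl _) ((shiftFunctorZero C ℤ).app (N j)) (h j hj) f
    · refine hom_eq_zero_of_hom_shift_eq_zero (hp.hom_excGE_exc hR (fun i hi => ?_)
        (hp.excGE_of_belowLevel (excGE_mono N R subset_rfl (show 1 ≤ n by lia) _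
          (excGE_shift N R _ 0 (-n) n (by simp) X hge)) (le_shift _ (-n) _ hX))) f
      rw [Set.mem_ofPred_eq] at hi
      lia
  refine ExcSeq.mem_belowLevel_of_hom_exc_eq_zero (fun i j n f hij =>
    hp.hom_eq_zero i j n f hij.le (by rintro ⟨rfl, -⟩; simp at hij)) hX fun Y hY _ f => ?_
  have : triClosure (fun Z => ∃ j, lvl j = m ∧ Z = N j) ≤ rightOrthogonal (fun Z => Z = X) := by
    refine triClosure_le_of_shift ?_
    rintro _ ⟨j, hj, rfl⟩ n _ g rfl
    exact h' j hj n g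
  exact this Y hY f rfl

theorem isZero_of_belowLevel_zero {X : C} (hX : belowLevel lvl N 0 X) : IsZero X := by
  have : belowLevel lvl N 0 ≤ leftOrthogonal (fun Z => Z = X) := by
    refine triClosure_le_of_shift ?_
    rintro _ ⟨j, hj, -⟩
    simp at hj
  rw [IsZero.iff_id_eq_zero]
  exact this X hX _ rfl

attribute [local instance] heartAbelian

/-- The functor `Hom(D j, -)` on the heart. -/
noncomputable def dualFunctor (j : J) :
    hp.tStructure.heart.FullSubcategory ⥤ AddCommGrpCat.{v} :=
  hp.tStructure.heart.ι ⋙ preadditiveCoyoneda.obj (op (D j))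

instance (j : J) : (hp.dualFunctor j).PreservesZeroMorphisms := by
  unfold dualFunctor
  infer_instance

theorem isNoetherianFiltration
    (hst : ∀ (m : ℕ) (X : C) (Q : ℕ → C) (g : ∀ n, X ⟶ Q n),
      (∀ n, ∃ h : Q n ⟶ Q (n + 1), g (n + 1) = g n ≫ h) →
      ∃ n₀, ∀ n ≥ n₀, ∀ j, lvl j = m → ∀ y : D j ⟶ X, y ≫ g n = 0 → y ≫ g n₀ = 0) :
    IsNoetherianFiltration lvl hp.dualFunctor (fun m X => belowLevel lvl N m X.obj) where
  zero X hX := by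
    have h : IsZero X.obj := hp.isZero_of_belowLevel_zero hX
    rw [IsZero.iff_id_eq_zero] at h ⊢
    ext
    exact h
  exists_mem X := hp.generates X.obj
  mono m X hX := belowLevel_mono _ _ (Nat.le_succ m) _ hX
  injective S hS j := by
    obtain ⟨δ, hT⟩ := heart_exists_distTriang_of_shortExact _ S hS
    refine (injective_iff_map_eq_zero ((hp.dualFunctor j).map S.f).hom).2 fun x hx => ?_
    exact eq_zero_of_comp_mor₁_eq_zero _ hT x hx
      (hp.hom_dualLE_excGE zero_lt_one (hp.dual_mem_dualLE j)
        (excGE_shift N R _ 0 (-1) 1 (by simp) _ S.X₃.property.2))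
  surjective S hS j h x := by
    obtain ⟨δ, hT⟩ := heart_exists_distTriang_of_shortExact _ S hS
    obtain ⟨y, hy⟩ := Triangle.coyoneda_exact₃ _ hT x
      (hp.hom_dual_shift_eq_zero S.X₁.property.1 h le_rfl zero_lt_one _)
    exact ⟨y, hy.symm⟩
  drop m X hX h := hp.mem_belowLevel_of_hom_dual_eq_zero hX X.property.1 X.property.2 h
  vanish m X hX j hj x := hp.hom_dual_belowLevel hj hX x
  quotient S hS m h₁ h₂ := by
    obtain ⟨δ, hT⟩ := heart_exists_distTriang_of_shortExact _ S hS
    exact (belowLevel lvl N m).ext_of_isTriangulatedClosed₃ _ hT h₁ h₂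
  stable m X Q g hg := hst m X.obj (fun n => (Q n).obj) (fun n => (g n).hom) fun n => by
    obtain ⟨h, hh⟩ := hg n
    exact ⟨h.hom, congrArg (fun φ => φ.hom) hh⟩

theorem isNoetherianObject
    (hst : ∀ (m : ℕ) (X : C) (Q : ℕ → C) (g : ∀ n, X ⟶ Q n),
      (∀ n, ∃ h : Q n ⟶ Q (n + 1), g (n + 1) = g n ≫ h) →
      ∃ n₀, ∀ n ≥ n₀, ∀ j, lvl j = m → ∀ y : D j ⟶ X, y ≫ g n = 0 → y ≫ g n₀ = 0)
    (X : hp.tStructure.heart.FullSubcategory) : IsNoetherianObject X :=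
  (hp.isNoetherianFiltration hst).isNoetherianObject X

/-- The functor `Hom(-, N j)` on the heart. -/
noncomputable def excFunctor (j : J) :
    hp.tStructure.heart.FullSubcategoryᵒᵖ ⥤ AddCommGrpCat.{v} :=
  hp.tStructure.heart.ι.op ⋙ preadditiveYoneda.obj (N j)

instance (j : J) : (hp.excFunctor j).PreservesZeroMorphisms := by
  unfold excFunctor
  infer_instance

theorem isNoetherianFiltration_op (hR : ∀ j B, R j B → IsZero B)
    (hst : ∀ (m : ℕ) (X : C) (Q : ℕ → C) (g : ∀ n, Q n ⟶ X),
      (∀ n, ∃ h : Q (n + 1) ⟶ Q n, g (n + 1) = h ≫ g n) →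
      ∃ n₀, ∀ n ≥ n₀, ∀ j, lvl j = m → ∀ y : X ⟶ N j, g n ≫ y = 0 → g n₀ ≫ y = 0) :
    IsNoetherianFiltration lvl hp.excFunctor (fun m X => belowLevel lvl N m X.unop.obj) where
  zero X hX := by
    have h : IsZero X.unop.obj := hp.isZero_of_belowLevel_zero hX
    rw [IsZero.iff_id_eq_zero] at h ⊢
    apply Quiver.Hom.unop_inj
    ext
    exact h
  exists_mem X := hp.generates X.unop.obj
  mono m X hX := belowLevel_mono _ _ (Nat.le_succ m) _ hX
  injective S hS j := by
    obtain ⟨δ, hT⟩ := heart_exists_distTriang_of_shortExact _ S.unop hS.unop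
    refine (injective_iff_map_eq_zero ((hp.excFunctor j).map S.f).hom).2 fun x hx => ?_
    obtain ⟨y, hy⟩ := Triangle.yoneda_exact₃ _ hT x hx
    rw [hp.hom_dualLE_excGE neg_one_lt_zero (dualLE_shift D _ 0 1 (-1) (by simp) _
      S.X₃.unop.property.1) (hp.exc_mem_excGE j) y] at hy
    exact hy.trans comp_zero
  surjective S hS j h x := by
    obtain ⟨δ, hT⟩ := heart_exists_distTriang_of_shortExact _ S.unop hS.unop
    have h1 := hp.excGE_of_belowLevel (excGE_shift N R _ 0 (-1) 1 (by simp) _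
      S.X₁.unop.property.2) (le_shift _ (-1) _ h)
    obtain ⟨y, hy⟩ := Triangle.yoneda_exact₂ _ (inv_rot_of_distTriang _ hT) x
      (hp.hom_excGE_exc hR (fun i hi => Nat.lt_succ_iff.1 hi) h1 _)
    exact ⟨y, hy.symm⟩
  drop m X hX h :=
    hp.mem_belowLevel_of_hom_exc_eq_zero hR hX X.unop.property.1 X.unop.property.2 h
  vanish m X hX j hj x := hp.hom_belowLevel_exc hj hX x
  quotient S hS m h₁ h₂ := by
    obtain ⟨δ, hT⟩ := heart_exists_distTriang_of_shortExact _ S.unop hS.unop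
    exact (belowLevel lvl N m).ext_of_isTriangulatedClosed₁ _ hT h₂ h₁
  stable m X Q g hg := hst m X.unop.obj (fun n => (Q n).unop.obj) (fun n => (g n).unop.hom)
    fun n => by
      obtain ⟨h, hh⟩ := hg n
      exact ⟨h.unop.hom, congrArg (fun φ => φ.unop.hom) hh⟩

theorem isArtinianObject (hR : ∀ j B, R j B → IsZero B)
    (hst : ∀ (m : ℕ) (X : C) (Q : ℕ → C) (g : ∀ n, Q n ⟶ X),
      (∀ n, ∃ h : Q (n + 1) ⟶ Q n, g (n + 1) = h ≫ g n) →
      ∃ n₀, ∀ n ≥ n₀, ∀ j, lvl j = m → ∀ y : X ⟶ N j, g n ≫ y = 0 → g n₀ ≫ y = 0)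
    (X : hp.tStructure.heart.FullSubcategory) : IsArtinianObject X := by
  have := (hp.isNoetherianFiltration_op hR hst).isNoetherianObject (op X)
  have h : WellFoundedLT (Subobject (op X))ᵒᵈ := inferInstance
  exact ⟨(Abelian.subobjectIsoSubobjectOp X).toOrderEmbedding.wellFoundedLT⟩

end IsDualPair

end ChainConditions

/-! ### Integer powers of the twist. -/

section TwistPowers

variable {C : Type u} [Category.{v} C]

theorem pow_succ_functor_iso (F : C ≌ C) (k : ℤ) :
    Nonempty ((F ^ (k + 1)).functor ≅ F.functor ⋙ (F ^ k).functor) := by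
  match k with
  | Int.ofNat 0 => exact ⟨(Functor.rightUnitor _).symm⟩
  | Int.ofNat (n + 1) => exact ⟨Iso.refl _⟩
  | Int.negSucc 0 => exact ⟨F.unitIso⟩
  | Int.negSucc (n + 1) =>
    exact ⟨(Functor.leftUnitor _).symm ≪≫ Functor.isoWhiskerRight F.unitIso _ ≪≫
      Functor.associator _ _ _⟩

theorem pow_add_functor_iso (F : C ≌ C) (k l : ℤ) :
    Nonempty ((F ^ k).functor ⋙ (F ^ l).functor ≅ (F ^ (k + l)).functor) := by
  induction k using Int.induction_on with
  | zero => rw [zero_add]; exact ⟨Functor.leftUnitor _⟩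
  | succ n ih =>
    obtain ⟨e⟩ := ih
    obtain ⟨e₁⟩ := pow_succ_functor_iso F n
    obtain ⟨e₂⟩ := pow_succ_functor_iso F (n + l)
    rw [show (n : ℤ) + 1 + l = n + l + 1 by ring]
    exact ⟨Functor.isoWhiskerRight e₁ _ ≪≫ Functor.associator _ _ _ ≪≫
      Functor.isoWhiskerLeft _ e ≪≫ e₂.symm⟩
  | pred n ih =>
    obtain ⟨e⟩ := ih
    obtain ⟨e₁⟩ := pow_succ_functor_iso F (-n - 1)
    obtain ⟨e₂⟩ := pow_succ_functor_iso F (-n - 1 + l)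
    rw [show -(n : ℤ) - 1 + 1 = -n by ring] at e₁
    rw [show -(n : ℤ) - 1 + l + 1 = -n + l by ring] at e₂
    -- Both sides agree after precomposition with `F`, which is then cancelled by its inverse.
    have e₃ : F.functor ⋙ (F ^ (-(n : ℤ) - 1)).functor ⋙ (F ^ l).functor ≅
        F.functor ⋙ (F ^ (-(n : ℤ) - 1 + l)).functor :=
      (Functor.associator _ _ _).symm ≪≫ Functor.isoWhiskerRight e₁.symm _ ≪≫ e ≪≫ e₂
    exact ⟨(Functor.leftUnitor _).symm ≪≫ Functor.isoWhiskerRight F.counitIso.symm _ ≪≫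
      Functor.associator _ _ _ ≪≫ Functor.isoWhiskerLeft _ e₃ ≪≫
      (Functor.associator _ _ _).symm ≪≫ Functor.isoWhiskerRight F.counitIso _ ≪≫
      Functor.leftUnitor _⟩

variable [Preadditive C] [HasZeroObject C] [HasShift C ℤ]
  [∀ n : ℤ, (shiftFunctor C n).Additive] [Pretriangulated C]

theorem powNat_functor_isTriangulated (F : C ≌ C) [F.functor.CommShift ℤ]
    [F.functor.IsTriangulated] :
    ∀ n : ℕ, ∃ _ : (F.powNat n).functor.CommShift ℤ, (F.powNat n).functor.IsTriangulated
  | 0 => ⟨inferInstanceAs ((𝟭 C).CommShift ℤ), inferInstanceAs ((𝟭 C).IsTriangulated)⟩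
  | 1 => ⟨inferInstanceAs (F.functor.CommShift ℤ), inferInstanceAs (F.functor.IsTriangulated)⟩
  | n + 2 => by
    obtain ⟨_, _⟩ := powNat_functor_isTriangulated F (n + 1)
    exact ⟨inferInstanceAs ((F.functor ⋙ (F.powNat (n + 1)).functor).CommShift ℤ),
      inferInstanceAs ((F.functor ⋙ (F.powNat (n + 1)).functor).IsTriangulated)⟩

theorem pow_functor_isTriangulated (F : C ≌ C) [F.functor.CommShift ℤ]
    [F.functor.IsTriangulated] (k : ℤ) :
    ∃ _ : (F ^ k).functor.CommShift ℤ, (F ^ k).functor.IsTriangulated := by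
  match k with
  | Int.ofNat n => exact powNat_functor_isTriangulated F n
  | Int.negSucc n =>
    let := F.commShiftInverse ℤ
    have := F.commShift_of_functor ℤ
    have : F.inverse.IsTriangulated := F.toAdjunction.isTriangulated_rightAdjoint
    exact powNat_functor_isTriangulated F.symm (n + 1)

variable (F : C ≌ C) [F.functor.CommShift ℤ] [F.functor.IsTriangulated]

theorem twist_shift_iso (k n : ℤ) (X : C) : Nonempty (twist F k (X⟦n⟧) ≅ (twist F k X)⟦n⟧) := by
  obtain ⟨_, _⟩ := pow_functor_isTriangulated F k
  exact ⟨((F ^ k).functor.commShiftIso n).app X⟩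

theorem twist_distTriang (k : ℤ) {X Y Z : C} {f : X ⟶ Y} {g : Y ⟶ Z} {h : Z ⟶ X⟦(1 : ℤ)⟧}
    (hT : Triangle.mk f g h ∈ distTriang C) :
    ∃ h' : twist F k Z ⟶ (twist F k X)⟦(1 : ℤ)⟧,
      Triangle.mk ((F ^ k).functor.map f) ((F ^ k).functor.map g) h' ∈ distTriang C := by
  obtain ⟨_, _⟩ := pow_functor_isTriangulated F k
  exact ⟨_, (F ^ k).functor.map_distinguished _ hT⟩

theorem twist_isZero (k : ℤ) {X : C} (hX : IsZero X) : IsZero (twist F k X) := by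
  obtain ⟨_, _⟩ := pow_functor_isTriangulated F k
  exact (F ^ k).functor.map_isZero hX

theorem twist_map_zero (k : ℤ) (X Y : C) : (F ^ k).functor.map (0 : X ⟶ Y) = 0 := by
  obtain ⟨_, _⟩ := pow_functor_isTriangulated F k
  exact (F ^ k).functor.map_zero X Y

theorem twist_map_eq_zero_iff (k : ℤ) {X Y : C} (f : X ⟶ Y) :
    (F ^ k).functor.map f = 0 ↔ f = 0 := by
  rw [← twist_map_zero F k, (F ^ k).functor.map_injective.eq_iff]

theorem twist_hom_eq_zero {X Y : C} {k l n : ℤ}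
    (h : ∀ f : X ⟶ twist F (l - k) (Y⟦n⟧), f = 0) (f : twist F k X ⟶ (twist F l Y)⟦n⟧) :
    f = 0 := by
  obtain ⟨e⟩ := twist_shift_iso F l n Y
  obtain ⟨e'⟩ := pow_add_functor_iso F (l - k) k
  rw [sub_add_cancel] at e'
  refine hom_eq_zero_of_isos (Iso.refl _) (e.symm ≪≫ e'.symm.app (Y⟦n⟧)) (fun f => ?_) f
  obtain ⟨f, rfl⟩ := (F ^ k).functor.map_surjective f
  rw [h f, twist_map_zero]

theorem extClosure_twist {P Q : ObjectProperty C} (k : ℤ)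
    (h : ∀ X, P X → extClosure Q (twist F k X)) {X : C} (hX : extClosure P X) :
    extClosure Q (twist F k X) := by
  induction hX with
  | of X hX => exact h X hX
  | zero X hX => exact extClosure.zero _ (twist_isZero F k hX)
  | ext T hT _ _ ih₁ ih₃ =>
    obtain ⟨h', hT'⟩ := twist_distTriang F k hT
    exact extClosure.ext _ hT' ih₁ ih₃

theorem triClosure_twist {P Q : ObjectProperty C} (k : ℤ)
    (h : ∀ X, P X → triClosure Q (twist F k X)) {X : C} (hX : triClosure P X) :
    triClosure Q (twist F k X) := by
  induction hX with
  | of X hX => exact h X hX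
  | zero X hX => exact triClosure.zero _ (twist_isZero F k hX)
  | shift X n _ ih =>
    obtain ⟨e⟩ := twist_shift_iso F k n X
    exact triClosure_of_iso _ e.symm (triClosure.shift _ n ih)
  | ext T hT _ _ ih₁ ih₃ =>
    obtain ⟨h', hT'⟩ := twist_distTriang F k hT
    exact triClosure.ext _ hT' ih₁ ih₃

variable {I : Type w'} (nabla : I → C) (e : I → ℕ)

theorem belowLevel_twist (k : ℤ) {m : ℕ} {X : C}
    (hX : belowLevel (fun j : I × ℤ => e j.1) (fun j => twist F j.2 (nabla j.1)) m X) :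
    belowLevel (fun j : I × ℤ => e j.1) (fun j => twist F j.2 (nabla j.1)) m (twist F k X) := by
  refine triClosure_twist F k ?_ hX
  rintro _ ⟨⟨i, l⟩, hj, rfl⟩
  obtain ⟨e'⟩ := pow_add_functor_iso F l k
  exact triClosure_of_iso _ (e'.symm.app (nabla i)) (triClosure.of _ ⟨⟨i, l + k⟩, hj, rfl⟩)

theorem generated_eq_belowLevel {m : ℕ} {s : Set I} (hs : ∀ i, i ∈ s ↔ e i < m) :
    generated F nabla s =
      belowLevel (fun j : I × ℤ => e j.1) (fun j => twist F j.2 (nabla j.1)) m := by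
  refine le_antisymm (triClosure_mono ?_) (triClosure_mono ?_)
  · rintro _ ⟨i, hi, k, rfl⟩
    exact ⟨(i, k), (hs i).1 hi, rfl⟩
  · rintro _ ⟨⟨i, k⟩, hi, rfl⟩
    exact ⟨i, (hs i).2 hi, k, rfl⟩

theorem exists_belowLevel_of_generated {X : C} (hX : generated F nabla Set.univ X) :
    ∃ m, belowLevel (fun j : I × ℤ => e j.1) (fun j => twist F j.2 (nabla j.1)) m X := by
  induction hX with
  | of X hX =>
    obtain ⟨i, -, k, rfl⟩ := hX
    exact ⟨e i + 1, triClosure.of _ ⟨(i, k), Nat.lt_succ_self _, rfl⟩⟩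
  | zero X hX => exact ⟨0, triClosure.zero X hX⟩
  | shift X n _ ih =>
    obtain ⟨m, hm⟩ := ih
    exact ⟨m, triClosure.shift X n hm⟩
  | ext T hT _ _ ih₁ ih₃ =>
    obtain ⟨m, hm⟩ := ih₁
    obtain ⟨m', hm'⟩ := ih₃
    exact ⟨max m m', triClosure.ext T hT (belowLevel_mono _ _ (le_max_left m m') _ hm)
      (belowLevel_mono _ _ (le_max_right m m') _ hm')⟩

end TwistPowers

/-! ### Lifting the isomorphism of the Verdier quotient to a map Δ_i → ∇_i. -/

section Comparison

variable {C : Type u} [Category.{v} C] [Preadditive C] [HasZeroObject C] [HasShift C ℤ]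
  [∀ n : ℤ, (shiftFunctor C n).Additive] [Pretriangulated C]

/-- If precomposition with `c` is bijective on morphisms to `Y` and to `Y[-1]`, then there are no
nonzero morphisms from the cone of `c` to `Y`. -/
theorem hom_cone_eq_zero {X X' Z Y : C} {c : X ⟶ X'} {g : X' ⟶ Z} {h : Z ⟶ X⟦(1 : ℤ)⟧}
    (hT : Triangle.mk c g h ∈ distTriang C)
    (h₀ : Function.Injective (fun y : X' ⟶ Y => c ≫ y))
    (h₁ : Function.Surjective (fun y : X' ⟶ Y⟦(-1 : ℤ)⟧ => c ≫ y)) (f : Z ⟶ Y) : f = 0 := by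
  have hcg : c ≫ g = 0 := comp_distTriang_mor_zero₁₂ _ hT
  have hgf : g ≫ f = 0 := h₀ (by simp [← Category.assoc, hcg])
  obtain ⟨y, hy⟩ : ∃ y : X⟦(1 : ℤ)⟧ ⟶ Y, f = h ≫ y := Triangle.yoneda_exact₃ _ hT f hgf
  obtain ⟨y', hy'⟩ : ∃ y' : X'⟦(1 : ℤ)⟧ ⟶ Y, y = c⟦(1 : ℤ)⟧' ≫ y' := by
    let adj := (shiftEquiv C (1 : ℤ)).toAdjunction
    obtain ⟨z, hz⟩ := h₁ (adj.homEquiv X Y y)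
    obtain ⟨y', hy'⟩ := (adj.homEquiv X' Y).surjective z
    refine ⟨y', (adj.homEquiv X Y).injective ?_⟩
    exact hz.symm.trans ((congrArg (fun z => c ≫ z) hy'.symm).trans
      (adj.homEquiv_naturality_left c y').symm)
  have hhc : h ≫ c⟦(1 : ℤ)⟧' = 0 := comp_distTriang_mor_zero₃₁ _ hT
  rw [hy, hy', ← Category.assoc, hhc, zero_comp]

variable [IsTriangulated C]
  (F : C ≌ C) [F.functor.CommShift ℤ] [F.functor.IsTriangulated]
  {I : Type w'} [LinearOrder I] {nabla delta : I → C}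

theorem hom_delta_generated_eq_zero (hdelta : IsDual F nabla delta) (i : I) {X : C}
    (hX : generated F nabla (Set.Iio i) X) (f : delta i ⟶ X) : f = 0 := by
  have : generated F nabla (Set.Iio i) ≤ rightOrthogonal (fun Y => Y = delta i) := by
    refine triClosure_le_of_shift ?_
    rintro _ ⟨j, hj, k, rfl⟩ n _ g rfl
    obtain ⟨e⟩ := twist_shift_iso F k n (nabla j)
    exact hom_eq_zero_of_isos (Iso.refl _) e.symm (hdelta.hom_eq_zero j i hj n k) g
  exact this X hX f rfl

/-- Maps out of Δ_i are the same in T_{≤i} and in the quotient, so the isomorphism lifts.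
Invertibility in the quotient alone would only put the cone in the thick closure of T_{<i}; that it
lies in T_{<i} itself is tested on objects right orthogonal to T_{<i}. -/
theorem exists_comparison (hdelta : IsDual F nabla delta) (e : I ↪o ℕ)
    (hN : ∀ (i j : I × ℤ) (n : ℤ) (f : twist F i.2 (nabla i.1) ⟶ (twist F j.2 (nabla j.1))⟦n⟧),
      e i.1 < e j.1 → f = 0) (i : I) :
    ∃ c : delta i ⟶ nabla i, (belowLevel (fun j : I × ℤ => e j.1)
      (fun j => twist F j.2 (nabla j.1)) (e i)).trW c := by
  have hIio := generated_eq_belowLevel F nabla e (m := e i) (s := Set.Iio i)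
    (fun j => by simp)
  have hIic := generated_eq_belowLevel F nabla e (m := e i + 1) (s := Set.Iic i)
    (fun j => by simp)
  obtain ⟨h, ⟨φ⟩⟩ := hdelta.quotient_iso i
  have hΔ : (TLT F nabla i).leftOrthogonal ⟨delta i, h⟩ := fun Y f hY => by
    ext
    exact hom_delta_generated_eq_zero F hdelta i hY f.hom
  let L := quotientFunctor F nabla i
  obtain ⟨c, hc⟩ := (leftOrthogonal.map_bijective_of_isTriangulated hΔ L
    (nablaLE F nabla i)).2 φ.hom
  have hiso : IsIso (L.map c) := by rw [hc]; infer_instance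
  -- Maps into such a `Y` may also be computed in the quotient, where `c` is invertible.
  have hbij : ∀ Y : C, generated F nabla (Set.Iic i) Y →
      (generated F nabla (Set.Iio i)).rightOrthogonal Y →
      Function.Bijective (fun y : nabla i ⟶ Y => c.hom ≫ y) := by
    intro Y hY hY'
    have hY'' : (TLT F nabla i).rightOrthogonal ⟨Y, hY⟩ := fun Z f hZ => by
      ext
      exact hY' f.hom hZ
    have hL := fun X => rightOrthogonal.map_bijective_of_isTriangulated hY'' L X
    refine ⟨fun y y' hyy => ?_, fun y => ?_⟩
    · have : c ≫ homMk (Y := ⟨Y, hY⟩) y = c ≫ homMk (Y := ⟨Y, hY⟩) y' := by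
        ext
        exact hyy
      have h' := congrArg L.map this
      rw [L.map_comp, L.map_comp, cancel_epi] at h'
      exact congrArg (fun ψ => ψ.hom) ((hL _).1 h')
    · obtain ⟨z, hz⟩ := (hL _).2 (inv (L.map c) ≫ L.map (homMk (X := ⟨delta i, h⟩)
        (Y := ⟨Y, hY⟩) y))
      refine ⟨z.hom, ?_⟩
      have : c ≫ z = homMk (X := ⟨delta i, h⟩) (Y := ⟨Y, hY⟩) y :=
        (hL _).1 (by rw [L.map_comp, hz, IsIso.hom_inv_id_assoc])
      exact congrArg (fun ψ => ψ.hom) this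
  obtain ⟨Z, g, k, hT⟩ := distinguished_cocone_triangle c.hom
  have hZ : generated F nabla (Set.Iic i) Z :=
    ObjectProperty.ext_of_isTriangulatedClosed₃ _ _ hT h (nablaLE F nabla i).property
  refine ⟨c.hom, Z, g, k, hT, mem_belowLevel_of_hom_exc_eq_zero hN (hIic ▸ hZ)
    fun Y hY hY' f => ?_⟩
  rw [← hIio] at hY'
  have hY'' : generated F nabla (Set.Iic i) Y := by
    rw [hIic]
    refine triClosure_mono ?_ Y hY
    rintro _ ⟨j, hj, rfl⟩
    exact ⟨j, by lia, rfl⟩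
  exact hom_cone_eq_zero hT (hbij Y hY'' hY').1
    (hbij _ (le_shift _ (-1) _ hY'') (le_shift _ (-1) _ hY')).2 f

end Comparison

/-! ### Stabilisation of kernels from graded Hom-finiteness. -/

section Finiteness

variable {C : Type u} [Category.{v} C] [Preadditive C]
  {E : Type w} [CommRing E] [IsNoetherianRing E] [Linear E C]

/-- As Hom(W⟨k⟩, X) ≅ Hom(W, X⟨-k⟩), all twists are controlled by an ascending chain in one
noetherian module, so `n₀` does not depend on `k`. -/
theorem stable_of_gradedHomFinite_left [HasZeroObject C] [HasShift C ℤ]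
    [∀ n : ℤ, (shiftFunctor C n).Additive] [Pretriangulated C] {F : C ≌ C}
    [F.functor.CommShift ℤ] [F.functor.IsTriangulated] (hfin : GradedHomFinite E F)
    (W X : C) (Q : ℕ → C) (g : ∀ n, X ⟶ Q n)
    (hg : ∀ n, ∃ h : Q n ⟶ Q (n + 1), g (n + 1) = g n ≫ h) :
    ∃ n₀, ∀ n ≥ n₀, ∀ (k : ℤ) (y : twist F k W ⟶ X), y ≫ g n = 0 → y ≫ g n₀ = 0 := by
  have := hfin W X
  let U : ℕ → Submodule E (DirectSum ℤ fun k => (W ⟶ twist F k X)) := fun n =>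
    { carrier := {x | ∀ k, x k ≫ (F ^ k).functor.map (g n) = 0}
      add_mem' := fun {a b} ha hb k => by
        rw [DirectSum.add_apply, Preadditive.add_comp, ha k, hb k, add_zero]
      zero_mem' := fun k => by rw [DirectSum.zero_apply, zero_comp]
      smul_mem' := fun r a ha k => by
        rw [DirectSum.smul_apply, Linear.smul_comp, ha k, smul_zero] }
  have hU : Monotone U := monotone_nat_of_le_succ fun n x hx k => by
    obtain ⟨h, hh⟩ := hg n
    rw [hh, Functor.map_comp, ← Category.assoc, hx k, zero_comp]
  obtain ⟨n₀, hn₀⟩ := monotone_stabilizes_iff_noetherian.2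
    (inferInstanceAs (IsNoetherian E (DirectSum ℤ fun k => (W ⟶ twist F k X)))) ⟨U, hU⟩
  refine ⟨n₀, fun n hn k y hy => ?_⟩
  obtain ⟨θ⟩ := pow_add_functor_iso F k (-k)
  rw [add_neg_cancel] at θ
  let θ' : W ≅ twist F (-k) (twist F k W) := θ.symm.app W
  let x : W ⟶ twist F (-k) X := θ'.hom ≫ (F ^ (-k)).functor.map y
  have hx : ∀ n, DirectSum.of (fun k => (W ⟶ twist F k X)) (-k) x ∈ U n ↔ y ≫ g n = 0 := by
    intro n
    have hkey : x ≫ (F ^ (-k)).functor.map (g n) = 0 ↔ y ≫ g n = 0 := by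
      rw [← twist_map_eq_zero_iff F (-k) (y ≫ g n), Functor.map_comp]
      simp only [x, Category.assoc]
      constructor
      · intro h
        rw [← cancel_epi θ'.hom, h, comp_zero]
      · intro h
        rw [h, comp_zero]
    rw [← hkey]
    constructor
    · intro h
      have := h (-k)
      rwa [DirectSum.of_eq_same] at this
    · intro h l
      obtain rfl | hl := eq_or_ne l (-k)
      · rwa [DirectSum.of_eq_same]
      · rw [DirectSum.of_eq_of_ne _ _ _ hl, zero_comp]
  rw [← hx] at hy ⊢
  exact (hn₀ n hn).ge hy

theorem stable_of_gradedHomFinite_right {F : C ≌ C} (hfin : GradedHomFinite E F)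
    (W X : C) (Q : ℕ → C) (g : ∀ n, Q n ⟶ X)
    (hg : ∀ n, ∃ h : Q (n + 1) ⟶ Q n, g (n + 1) = h ≫ g n) :
    ∃ n₀, ∀ n ≥ n₀, ∀ (k : ℤ) (y : X ⟶ twist F k W), g n ≫ y = 0 → g n₀ ≫ y = 0 := by
  have := hfin X W
  let U : ℕ → Submodule E (DirectSum ℤ fun k => (X ⟶ twist F k W)) := fun n =>
    { carrier := {x | ∀ k, g n ≫ x k = 0}
      add_mem' := fun {a b} ha hb k => by
        rw [DirectSum.add_apply, Preadditive.comp_add, ha k, hb k, add_zero]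
      zero_mem' := fun k => by rw [DirectSum.zero_apply, comp_zero]
      smul_mem' := fun r a ha k => by
        rw [DirectSum.smul_apply, Linear.comp_smul, ha k, smul_zero] }
  have hU : Monotone U := monotone_nat_of_le_succ fun n x hx k => by
    obtain ⟨h, hh⟩ := hg n
    rw [hh, Category.assoc, hx k, comp_zero]
  obtain ⟨n₀, hn₀⟩ := monotone_stabilizes_iff_noetherian.2
    (inferInstanceAs (IsNoetherian E (DirectSum ℤ fun k => (X ⟶ twist F k W)))) ⟨U, hU⟩
  refine ⟨n₀, fun n hn k y hy => ?_⟩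
  have hx : ∀ n, DirectSum.of (fun k => (X ⟶ twist F k W)) k y ∈ U n ↔ g n ≫ y = 0 := by
    intro n
    constructor
    · intro h
      have := h k
      rwa [DirectSum.of_eq_same] at this
    · intro h l
      obtain rfl | hl := eq_or_ne l k
      · rwa [DirectSum.of_eq_same]
      · rw [DirectSum.of_eq_of_ne _ _ _ hl, comp_zero]
  rw [← hx] at hy ⊢
  exact (hn₀ n hn).ge hy

end Finiteness

/-! ### Powers of the uniformizer and the cones of scalars. -/

section Uniformizer

variable {E : Type w} [CommRing E] [IsDomain E] [IsPrincipalIdealRing E] [IsLocalRing E] {ϖ : E}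

theorem eq_unit_mul_pow_uniformizer (hϖ : IsLocalRing.maximalIdeal E = Ideal.span {ϖ}) {a : E}
    (ha : a ≠ 0) : ∃ (u : Eˣ) (r : ℕ), a = u * ϖ ^ r ∧ (IsField E → r = 0) := by
  by_cases hE : IsField E
  · obtain ⟨b, hb⟩ := hE.mul_inv_cancel ha
    exact ⟨Units.mkOfMulEqOne a b hb, 0, by simp, fun _ => rfl⟩
  · have : IsDiscreteValuationRing E :=
      ⟨fun h => hE (IsLocalRing.isField_iff_maximalIdeal_eq.2 h)⟩
    obtain ⟨r, u, h⟩ := IsDiscreteValuationRing.eq_unit_mul_pow_irreducible ha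
      ((IsDiscreteValuationRing.irreducible_iff_uniformizer ϖ).2 hϖ)
    exact ⟨u, r, h, fun h => absurd h hE⟩

theorem uniformizer_ne_zero (hϖ : IsLocalRing.maximalIdeal E = Ideal.span {ϖ})
    (hE : ¬ IsField E) : ϖ ≠ 0 := by
  rintro rfl
  exact hE (IsLocalRing.isField_iff_maximalIdeal_eq.2 (by rw [hϖ, Ideal.span_singleton_zero]))

end Uniformizer

section Reduction

variable {C : Type u} [Category.{v} C] [Preadditive C] [HasZeroObject C] [HasShift C ℤ]
  [∀ n : ℤ, (shiftFunctor C n).Additive] [Pretriangulated C]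

theorem extClosure_cone_comp [IsTriangulated C] {P : ObjectProperty C} {X Y Z : C} {f : X ⟶ Y}
    {g : Y ⟶ Z}
    (hf : ∀ (W : C) (a : Y ⟶ W) (b : W ⟶ X⟦(1 : ℤ)⟧), Triangle.mk f a b ∈ distTriang C →
      extClosure P W)
    (hg : ∀ (W : C) (a : Z ⟶ W) (b : W ⟶ Y⟦(1 : ℤ)⟧), Triangle.mk g a b ∈ distTriang C →
      extClosure P W)
    (W : C) (a : Z ⟶ W) (b : W ⟶ X⟦(1 : ℤ)⟧) (hT : Triangle.mk (f ≫ g) a b ∈ distTriang C) :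
    extClosure P W := by
  obtain ⟨W₁, a₁, b₁, hT₁⟩ := distinguished_cocone_triangle f
  obtain ⟨W₂, a₂, b₂, hT₂⟩ := distinguished_cocone_triangle g
  exact extClosure.ext _ (Triangulated.someOctahedron rfl hT₁ hT₂ hT).mem (hf _ _ _ hT₁)
    (hg _ _ _ hT₂)

variable {E : Type w} [CommRing E] [Linear E C]

theorem smul_id_comp_smul_id (a b : E) (X : C) :
    (a • 𝟙 X) ≫ (b • 𝟙 X) = (a * b) • 𝟙 X := by
  rw [Linear.smul_comp, Category.id_comp, smul_smul]

/-- Multiplication by a unit of the ground ring, as an automorphism. -/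
def unitSmulIso (a : Eˣ) (X : C) : X ≅ X where
  hom := (a : E) • 𝟙 X
  inv := ((a⁻¹ : Eˣ) : E) • 𝟙 X
  hom_inv_id := by rw [smul_id_comp_smul_id, Units.mul_inv, one_smul]
  inv_hom_id := by rw [smul_id_comp_smul_id, Units.inv_mul, one_smul]

theorem exists_eq_smul_id {X : C} (φ : End X ≃ₐ[E] E) (f : X ⟶ X) : ∃ a : E, f = a • 𝟙 X := by
  refine ⟨φ f, φ.injective ?_⟩
  have h : φ (𝟙 X) = 1 := φ.map_one
  have h' : φ (φ f • 𝟙 X) = φ f • φ (𝟙 X) := map_smul φ (φ f) (𝟙 X : End X)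
  rw [h', h, smul_eq_mul, mul_one]

theorem eq_zero_of_smul_id_eq_zero {X : C} (φ : End X ≃ₐ[E] E) {a : E} (h : a • 𝟙 X = 0) :
    a = 0 := by
  have h₁ : φ (𝟙 X) = 1 := φ.map_one
  have h₂ : φ (a • 𝟙 X) = a • φ (𝟙 X) := map_smul φ a (𝟙 X : End X)
  have h₃ : φ (0 : X ⟶ X) = 0 := φ.map_zero
  rwa [h, h₃, h₁, smul_eq_mul, mul_one, eq_comm] at h₂

variable [IsDomain E] [IsPrincipalIdealRing E] [IsLocalRing E] {ϖ : E}

/-- For a = uϖ^r the octahedral axiom filters the cone by r copies of the reduction; the unit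
contributes a zero cone. -/
theorem extClosure_cone_smul_id [IsTriangulated C]
    (hϖ : IsLocalRing.maximalIdeal E = Ideal.span {ϖ}) {a : E} (ha : a ≠ 0)
    {N : C} (W : C) (g : N ⟶ W) (h : W ⟶ N⟦(1 : ℤ)⟧)
    (hT : Triangle.mk (a • 𝟙 N) g h ∈ distTriang C) : extClosure (IsReduction ϖ N) W := by
  have hunit : ∀ (u : Eˣ) (W : C) (g : N ⟶ W) (h : W ⟶ N⟦(1 : ℤ)⟧),
      Triangle.mk ((u : E) • 𝟙 N) g h ∈ distTriang C → extClosure (IsReduction ϖ N) W :=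
    fun u W g h hT => extClosure.zero _ (Triangle.isZero₃_of_isIso₁ _ hT
      (inferInstanceAs (IsIso (unitSmulIso u N).hom)))
  obtain ⟨u, r, rfl, hr⟩ := eq_unit_mul_pow_uniformizer hϖ ha
  by_cases hE : IsField E
  · rw [hr hE, pow_zero, mul_one] at hT
    exact hunit u W g h hT
  · rw [← smul_id_comp_smul_id] at hT
    refine extClosure_cone_comp (hunit u) ?_ W g h hT
    clear hr ha hT g h W
    induction r with
    | zero => exact fun W g h hT => hunit 1 W g h (by simpa using hT)
    | succ r ih =>
      rw [pow_succ, ← smul_id_comp_smul_id]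
      exact extClosure_cone_comp ih fun W g h hT => extClosure.of _ (Or.inr ⟨hE, g, h, hT⟩)

/-- As Hom(N, N[1]) = 0, every map N → B is a scalar followed by `g`; the scalar is a unit, or it is
divisible by ϖ and the map vanishes. -/
theorem IsReduction.isZero_or (hϖ : IsLocalRing.maximalIdeal E = Ideal.span {ϖ}) {N B : C}
    (φ : End N ≃ₐ[E] E) (h₁ : ∀ f : N ⟶ N⟦(1 : ℤ)⟧, f = 0) (hB : IsReduction ϖ N B) :
    IsZero B ∨ ∃ (g : N ⟶ B) (h : B ⟶ N⟦(1 : ℤ)⟧), Triangle.mk (ϖ • 𝟙 N) g h ∈ distTriang C ∧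
      (∀ q : N ⟶ N, q ≫ (ϖ • 𝟙 N) = 0 → q = 0) ∧
      ∀ g' : N ⟶ B, g' = 0 ∨ ∃ u : N ≅ N, g' = u.hom ≫ g := by
  obtain ⟨-, hB⟩ | ⟨hE, g, h, hT⟩ := hB
  · exact Or.inl hB
  refine Or.inr ⟨g, h, hT, fun q hq => ?_, fun g' => ?_⟩
  · obtain ⟨a, rfl⟩ := exists_eq_smul_id φ q
    rw [smul_id_comp_smul_id] at hq
    rw [(mul_eq_zero.1 (eq_zero_of_smul_id_eq_zero φ hq)).resolve_right
      (uniformizer_ne_zero hϖ hE), zero_smul]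
  · obtain ⟨y, hy⟩ : ∃ y : N ⟶ N, g' = y ≫ g := Triangle.coyoneda_exact₃ _ hT g' (h₁ _)
    obtain ⟨a, rfl⟩ := exists_eq_smul_id φ y
    by_cases ha : IsUnit a
    · exact Or.inr ⟨unitSmulIso ha.unit N, hy⟩
    · left
      have ha' : a ∈ Ideal.span {ϖ} := hϖ ▸ (IsLocalRing.mem_maximalIdeal a).2 ha
      obtain ⟨b, rfl⟩ := Ideal.mem_span_singleton'.1 ha'
      have h₀ : (ϖ • 𝟙 N) ≫ g = 0 := comp_distTriang_mor_zero₁₂ _ hT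
      rw [hy, ← smul_id_comp_smul_id, Category.assoc, h₀, comp_zero]

end Reduction

/-! ### The twisted sequences form a dual pair. -/

section Twisted

variable {E : Type w} [CommRing E] [IsDomain E] [IsPrincipalIdealRing E] [IsLocalRing E]
  {ϖ : E}
  {C : Type u} [Category.{v} C] [Preadditive C] [HasZeroObject C] [HasShift C ℤ]
  [∀ n : ℤ, (shiftFunctor C n).Additive] [Pretriangulated C] [IsTriangulated C]
  [Linear E C]
  (F : C ≌ C) [F.functor.CommShift ℤ] [F.functor.IsTriangulated]
  {I : Type w'} [LinearOrder I] {nabla delta : I → C}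

/-- The twists of the models of the cone of `ϖ` on `N`. -/
def twistedReduction (ϖ : E) (N : C) (k : ℤ) : ObjectProperty C :=
  fun B => ∃ B₀, IsReduction ϖ N B₀ ∧ B = twist F k B₀

theorem extClosure_cone_twist (hϖ : IsLocalRing.maximalIdeal E = Ideal.span {ϖ}) {N : C}
    (φ : End N ≃ₐ[E] E) (k : ℤ) (X : C) (q : twist F k N ⟶ twist F k N) (g : twist F k N ⟶ X)
    (h : X ⟶ (twist F k N)⟦(1 : ℤ)⟧) (hT : Triangle.mk q g h ∈ distTriang C) (hq : q ≠ 0) :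
    extClosure (twistedReduction F ϖ N k) X := by
  obtain ⟨q, rfl⟩ := (F ^ k).functor.map_surjective q
  obtain ⟨a, rfl⟩ := exists_eq_smul_id φ q
  have ha : a ≠ 0 := by
    rintro rfl
    exact hq (by rw [zero_smul, twist_map_zero])
  obtain ⟨W, g₀, h₀, hT₀⟩ := distinguished_cocone_triangle (a • 𝟙 N)
  obtain ⟨h', hT'⟩ := twist_distTriang F k hT₀
  have e := isoTriangleOfIso₁₂ _ _ hT' hT (Iso.refl _) (Iso.refl _)
    ((Category.comp_id _).trans (Category.id_comp _).symm)
  exact extClosure_of_iso _ (Triangle.π₃.mapIso e)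
    (extClosure_twist F k (fun B hB => extClosure.of _ ⟨B, hB, rfl⟩)
      (extClosure_cone_smul_id hϖ ha W g₀ h₀ hT₀))

theorem twistedReduction_isZero_or (hϖ : IsLocalRing.maximalIdeal E = Ideal.span {ϖ}) {N B : C}
    (φ : End N ≃ₐ[E] E) (h₁ : ∀ f : N ⟶ N⟦(1 : ℤ)⟧, f = 0) (k : ℤ)
    (hB : twistedReduction F ϖ N k B) :
    IsZero B ∨ ∃ (p : twist F k N ⟶ twist F k N) (g : twist F k N ⟶ B)
      (h : B ⟶ (twist F k N)⟦(1 : ℤ)⟧), Triangle.mk p g h ∈ distTriang C ∧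
      (∀ q : twist F k N ⟶ twist F k N, q ≫ p = 0 → q = 0) ∧
      ∀ g' : twist F k N ⟶ B, g' = 0 ∨ ∃ u : twist F k N ≅ twist F k N, g' = u.hom ≫ g := by
  obtain ⟨B, hB, rfl⟩ := hB
  obtain hB | ⟨g, h, hT, hinj, hg⟩ := hB.isZero_or hϖ φ h₁
  · exact Or.inl (twist_isZero F k hB)
  obtain ⟨h', hT'⟩ := twist_distTriang F k hT
  refine Or.inr ⟨_, _, h', hT', fun q hq => ?_, fun g' => ?_⟩
  · obtain ⟨q, rfl⟩ := (F ^ k).functor.map_surjective q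
    rw [← Functor.map_comp, twist_map_eq_zero_iff] at hq
    rw [hinj q hq, twist_map_zero]
  · obtain ⟨g', rfl⟩ := (F ^ k).functor.map_surjective g'
    obtain rfl | ⟨u, rfl⟩ := hg g'
    · exact Or.inl (twist_map_zero F k _ _)
    · exact Or.inr ⟨(F ^ k).functor.mapIso u, (F ^ k).functor.map_comp _ _⟩

theorem isDualPair_twist (hϖ : IsLocalRing.maximalIdeal E = Ideal.span {ϖ})
    (hnabla : IsExceptional E F nabla) (hdelta : IsDual F nabla delta) (e : I ↪o ℕ) :
    IsDualPair (fun j : I × ℤ => e j.1) (fun j => twist F j.2 (nabla j.1))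
      (fun j => twist F j.2 (delta j.1)) (fun j => twistedReduction F ϖ (nabla j.1) j.2) := by
  have hN : ∀ (i j : I × ℤ) (n : ℤ)
      (f : twist F i.2 (nabla i.1) ⟶ (twist F j.2 (nabla j.1))⟦n⟧), e i.1 ≤ e j.1 →
      ¬(i = j ∧ n = 0) → f = 0 := by
    rintro ⟨i, k⟩ ⟨j, l⟩ n f hij hne
    obtain hij | rfl := (e.le_iff_le.1 hij).lt_or_eq
    · exact twist_hom_eq_zero F (hnabla.hom_eq_zero i j hij n (l - k)) f
    · refine twist_hom_eq_zero F (hnabla.self_hom_eq_zero i n (l - k) ?_) f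
      rintro ⟨rfl, hkl⟩
      obtain rfl : l = k := sub_eq_zero.1 hkl
      exact hne ⟨rfl, rfl⟩
  refine ⟨hN, ?_, fun X => exists_belowLevel_of_generated F nabla e (hnabla.generates X), ?_, ?_,
    ?_⟩
  · rintro ⟨i, k⟩ ⟨j, l⟩ n f hij
    exact twist_hom_eq_zero F (hdelta.hom_eq_zero i j (e.lt_iff_lt.1 hij) n (k - l)) f
  · rintro ⟨i, k⟩
    obtain ⟨c, Z, g, h, hT, hZ⟩ := exists_comparison F hdelta e
      (fun i j n f hij => hN i j n f hij.le (by rintro ⟨rfl, -⟩; exact hij.ne rfl)) i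
    obtain ⟨h', hT'⟩ := twist_distTriang F k hT
    exact ⟨(F ^ k).functor.map c, twist F k Z, _, h', hT', belowLevel_twist F nabla e k hZ⟩
  · rintro ⟨i, k⟩ X q g h hT hq
    obtain ⟨φ⟩ := hnabla.end_equiv i
    exact extClosure_cone_twist F hϖ φ k X q g h hT hq
  · rintro ⟨i, k⟩ B hB
    obtain ⟨φ⟩ := hnabla.end_equiv i
    exact twistedReduction_isZero_or F hϖ φ
      (hnabla.self_hom_eq_zero i 1 0 (by simp)) k hB

theorem dualLE_twist_eq_tLE (delta : I → C) :
    dualLE (fun j : I × ℤ => twist F j.2 (delta j.1)) Set.univ 0 = tLE F delta := by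
  unfold tLE
  refine le_antisymm (extClosure_le ?_) (extClosure_mono ?_)
  · rintro X ⟨⟨j, k⟩, -, n, hn, ⟨e⟩⟩
    obtain ⟨e'⟩ := twist_shift_iso F k n (delta j)
    exact extClosure_of_iso _ (e' ≪≫ e.symm) (extClosure.of _ ⟨j, n, k, by simpa using hn, rfl⟩)
  · rintro _ ⟨j, n, k, hn, rfl⟩
    exact ⟨(j, k), Set.mem_univ _, n, by simpa using hn, twist_shift_iso F k n (delta j)⟩

theorem excGE_twist_eq_tGE (ϖ : E) (nabla : I → C) :
    excGE (fun j : I × ℤ => twist F j.2 (nabla j.1))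
      (fun j => twistedReduction F ϖ (nabla j.1) j.2) Set.univ 0 = tGE ϖ F nabla := by
  unfold tGE
  refine le_antisymm (extClosure_le ?_) (extClosure_mono ?_)
  · rintro X ⟨⟨j, k⟩, -, n, hn, _, rfl | ⟨B, hB, rfl⟩, ⟨e⟩⟩
    · obtain ⟨e'⟩ := twist_shift_iso F k n (nabla j)
      exact extClosure_of_iso _ (e' ≪≫ e.symm)
        (extClosure.of _ ⟨j, n, k, by simpa using hn, Or.inl rfl⟩)
    · obtain ⟨e'⟩ := twist_shift_iso F k n B
      exact extClosure_of_iso _ (e' ≪≫ e.symm)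
        (extClosure.of _ ⟨j, n, k, by simpa using hn, Or.inr ⟨B, hB, rfl⟩⟩)
  · rintro _ ⟨j, n, k, hn, rfl | ⟨B, hB, rfl⟩⟩
    · exact ⟨(j, k), Set.mem_univ _, n, by simpa using hn, _, Or.inl rfl,
        twist_shift_iso F k n (nabla j)⟩
    · exact ⟨(j, k), Set.mem_univ _, n, by simpa using hn, _, Or.inr ⟨B, hB, rfl⟩,
        twist_shift_iso F k n B⟩

end Twisted

end ExcSeq

theorem mainTheorem8
    {E : Type w} [CommRing E] [IsDomain E] [IsPrincipalIdealRing E] [IsLocalRing E]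
    [IsAdicComplete (IsLocalRing.maximalIdeal E) E]
    (ϖ : E) (hϖ : IsLocalRing.maximalIdeal E = Ideal.span {ϖ})
    {C : Type u} [Category.{v} C] [Preadditive C] [HasZeroObject C] [HasShift C ℤ]
    [∀ n : ℤ, (shiftFunctor C n).Additive] [Pretriangulated C] [IsTriangulated C]
    [Linear E C] [∀ n : ℤ, (shiftFunctor C n).Linear E]
    (F : C ≌ C) [F.functor.CommShift ℤ] [F.functor.IsTriangulated]
    (hfin : ExcSeq.GradedHomFinite E F)
    {I : Type w'} [LinearOrder I] (nabla delta : I → C)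
    (hnabla : ExcSeq.IsExceptional E F nabla) (hdelta : ExcSeq.IsDual F nabla delta) :
    ∃ t : Triangulated.TStructure C,
      t.le 0 = ExcSeq.tLE F delta ∧
      t.ge 0 = ExcSeq.tGE ϖ F nabla ∧
      Nonempty (Abelian t.heart.FullSubcategory) ∧
      (∀ X : t.heart.FullSubcategory, IsNoetherianObject X) ∧
      (IsField E → ∀ X : t.heart.FullSubcategory, IsArtinianObject X) := by
  obtain ⟨e⟩ := hnabla.index
  have hp := ExcSeq.isDualPair_twist F hϖ hnabla hdelta e
  refine ⟨hp.tStructure, ExcSeq.dualLE_twist_eq_tLE F delta, ExcSeq.excGE_twist_eq_tGE F ϖ nabla,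
    ⟨ExcSeq.heartAbelian _⟩, fun X => ?_, fun hE X => ?_⟩
  · refine hp.isNoetherianObject (fun m X Q g hg => ?_) X
    -- Since `e` is injective, a level contains only the twists of a single object, so one
    -- finiteness statement suffices; other levels are empty.
    by_cases hm : ∃ i, e i = m
    · obtain ⟨i, rfl⟩ := hm
      obtain ⟨n₀, h⟩ := ExcSeq.stable_of_gradedHomFinite_left hfin (delta i) X Q g hg
      refine ⟨n₀, fun n hn ⟨j, k⟩ hj => ?_⟩
      obtain rfl := e.injective hj
      exact h n hn k
    · exact ⟨0, fun n _ j hj => absurd ⟨j.1, hj⟩ hm⟩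
  · refine hp.isArtinianObject ?_ (fun m X Q g hg => ?_) X
    · rintro ⟨i, k⟩ _ ⟨B, ⟨-, hB⟩ | ⟨hE', -⟩, rfl⟩
      · exact ExcSeq.twist_isZero F k hB
      · exact absurd hE hE'
    · by_cases hm : ∃ i, e i = m
      · obtain ⟨i, rfl⟩ := hm
        obtain ⟨n₀, h⟩ := ExcSeq.stable_of_gradedHomFinite_right hfin (nabla i) X Q g hg
        refine ⟨n₀, fun n hn ⟨j, k⟩ hj => ?_⟩
        obtain rfl := e.injective hj
        exact h n hn k
      · exact ⟨0, fun n _ j hj => absurd ⟨j.1, hj⟩ hm⟩
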